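/- \textbf{Setting.} Let $\mathcal X$ be a (measurable) set of outcomes, $\mathcal Y\subseteq\mathbb R^d$ a convex set of predictions, and $\mathcal L:\mathcal X\times\mathcal Y\to\mathbb R$ a loss function such that, for every $x$, $\mathcal L(x,\cdot)$ is strongly convex with constant $\rho>0$ and Lipschitz with constant $\kappa$ in the Euclidean norm. An observation is a partial function with finite domain from $\mathbb N$ to $\mathcal X$. The environment is a joint distribution of outcomes $X_1,X_2,\dots\in\mathcal X$ and observations $O_1,O_2,\dots$ such that almost surely $O_i(n)=X_n$ whenever $O_i(n)$ is defined. Write $O_{\le n}=(O_1,\dots,O_n)$. A forecaster is a (measurable) partial function $f$ which on input $O_{\le n}$ may output a prediction $f(O_{\le n})\in\mathcal Y$ of $X_n$. It is Bayes-optimal if for every $n$: almost surely, if $f(O_{\le n})$ is defined then $O_N(n)$ is defined for some $N$; and, whenever it is defined, $f(O_{\le n})$ minimizes $\mathbb E[\mathcal L(X_n,y)\mid O_{\le n}]$ over $y\in\mathcal Y$ (these expectations being finite). \textbf{Algorithm.} Let $\mathcal F=\{f_1,\dots,f_K\}$ be a finite family of forecasters and fix $0<\varepsilon<1$. On input $O_{\le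 n}$: $\mathrm{TestSeq}_n(i,j,m)$ runs through $k=1,\dots,n$, starting in the state ``not waiting''. If it is waiting for feedback on $t$ and $t\in\mathrm{Dom}(O_k)$, it outputs $t$ and stops waiting; if it is not waiting and $f_i(O_{\le k}),f_j(O_{\le k})$ are both defined with $\|f_i(O_{\le k})-f_j(O_{\le k})\|>1/m$ (where $1/0=\infty$), it starts waiting for feedback on $t=k$. $\mathrm{RelScore}_n(i,j,m)=\sum_{s}\bigl(\mathcal L(x_s,f_i(O_{\le s}))-\mathcal L(x_s,f_j(O_{\le s}))-\frac{\rho\varepsilon}{2m^2}\bigr)$, the sum being over the outputs $s$ of $\mathrm{TestSeq}_n(i,j,m)$, and $x_s$ being the revealed value of the $s$-th outcome. $\mathrm{MaxScore}_n(i)=\max_{1\le j\le K,\ m\ge 0}\bigl(i-j-m+\mathrm{RelScore}_n(i,j,m)\bigr)$. $\mathrm{EvOp}(O_{\le n})=f_i(O_{\le n})$, where $i$ minimizes $\mathrm{MaxScore}_n(i)$ among the indices for which $f_i(O_{\le n})$ is defined (the least such $i$ in case of a tie). \textbf{Theorem.} Let $f_z\in\mathcal F$ be Bayes-optimal, let $m\ge1$,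 and let $h,g:\mathbb N\to\mathbb N$ be increasing (not necessarily strictly) functions such that almost surely: (a) for every $j\ne z$ and every time $t\ge1$ there is a $t'$ with $t<t'<h(t)$ such that $f_z(O_{\le t'})$ and $f_j(O_{\le t'})$ are both defined and $\|f_z(O_{\le t'})-f_j(O_{\le t'})\|>1/m$; (b) for every $t\ge1$, feedback on the $t$-th outcome arrives after time $t$ and no later than time $g(t)$, that is, $O_k(t)$ is defined for some $t<k\le g(t)$. Then there is a constant $C$, depending only on $\rho,\kappa,\varepsilon,m$ and $K$, such that for every $p\in(0,1]$, with $$N=(h\circ g)^{\lceil C(1+\log(1/p))\rceil}(1)$$ (the exponent denoting iteration), with probability at least $1-p$, $$\mathrm{EvOp}(O_{\le n})=f_z(O_{\le n})\quad\text{for all } n\ge N \text{ for which } f_z(O_{\le n}) \text{ is defined}$$ (that is, for all $n\ge N$ if $f_z$ is defined everywhere), and, in the same event, the total excess loss of $\mathrm{EvOp}$ over $f_z$ never exceeds $L\cdot N$: $$\sum_{i\le n,\ f_z(O_{\le i})\text{ defined}}\bigl(\mathcal L(X_i,\mathrm{EvOp}(O_{\le i}))-\mathcal L(X_i,f_z(O_{\le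 i}))\bigr)\le L\cdot N\quad\text{for all } n,$$ where $L\ge0$ is any bound with $\mathcal L(x,y)-\mathcal L(x,y')\le L$ for all $x\in\mathcal X$, $y,y'\in\mathcal Y$; such an $L$ exists. -/

import Mathlib

namespace UnboundedDelay

open MeasureTheory

/-- The `σ`-algebra on `Option α` for which `some` is a measurable embedding and `{none}` is
measurable (disjoint union of `α` and a point). -/
instance optionMeasurableSpace {α : Type*} [MeasurableSpace α] : MeasurableSpace (Option α) :=
  MeasurableSpace.comap (Equiv.optionEquivSumPUnit.{0} α) inferInstance

/-- An observation: a partial function with finite domain from indices to outcomes. -/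
structure Observation (X : Type*) where
  /-- the value revealed for a given index, if any -/
  val : ℕ → Option X
  finite_dom : {n | (val n).isSome}.Finite

instance observationMeasurableSpace {X : Type*} [MeasurableSpace X] :
    MeasurableSpace (Observation X) :=
  MeasurableSpace.comap Observation.val inferInstance

/-- The value of the `n`-th outcome according to a list of observations, if one of them
reveals it. -/
def revealed {X : Type*} (o : List (Observation X)) (n : ℕ) : Option X :=
  o.findSome? fun a => a.val n

/-- A forecaster: a partial function which takes a finite list of observations `o₁, …, oₙ` and
may output a prediction in `Y`, interpreted as a prediction of the `n`-th outcome. -/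
abbrev Forecaster (X : Type*) {E : Type*} (Y : Set E) : Type _ :=
  List (Observation X) → Option Y

/-- Measurability of a forecaster, for each number of observations. -/
def Forecaster.IsMeasurable {X E : Type*} [MeasurableSpace X] [MeasurableSpace E] {Y : Set E}
    (f : Forecaster X Y) : Prop :=
  ∀ n : ℕ, Measurable fun o : Fin n → Observation X => f (List.ofFn o)

/-- The true environment: a joint law of outcomes `X₁, X₂, …` and observations `O₁, O₂, …`
(realized as random variables on a probability space `(Ω, μ)`) such that almost surely
everything that is revealed agrees with the true outcomes. The index `0` is not used. -/
structure Environment (X : Type*) [MeasurableSpace X] {Ω : Type*} [MeasurableSpace Ω]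
    (μ : Measure Ω) where
  outcome : ℕ → Ω → X
  obs : ℕ → Ω → Observation X
  measurable_outcome : ∀ n, Measurable (outcome n)
  measurable_obs : ∀ i, Measurable (obs i)
  consistent : ∀ i n, 1 ≤ i → 1 ≤ n →
    ∀ᵐ ω ∂μ, ∀ x, (obs i ω).val n = some x → outcome n ω = x

section Env

variable {X : Type*} [MeasurableSpace X] {Ω : Type*} [MeasurableSpace Ω] {μ : Measure Ω}

/-- The first `n` observations `O₁, …, Oₙ`, as a random tuple. -/
def Environment.obsTuple (P : Environment X μ) (n : ℕ) (ω : Ω) : Fin n → Observation X :=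
  fun i => P.obs (i + 1) ω

/-- The first `n` observations `O₁, …, Oₙ`, as a list. -/
def Environment.history (P : Environment X μ) (n : ℕ) (ω : Ω) : List (Observation X) :=
  List.ofFn (P.obsTuple n ω)

/-- The `σ`-algebra generated by the first `n` observations. -/
abbrev Environment.sigma (P : Environment X μ) (n : ℕ) : MeasurableSpace Ω :=
  MeasurableSpace.comap (P.obsTuple n) inferInstance

/-- A forecaster is Bayes-optimal if everything it predicts is almost surely eventually revealed
and if, whenever it makes a prediction, this prediction minimizes over `Y` the conditional
expectation of the loss given the observations so far (these expected losses being finite). -/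
structure IsBayesOptimal {E : Type*} {Y : Set E} (P : Environment X μ) (loss : X → E → ℝ)
    (f : Forecaster X Y) : Prop where
  eventually_revealed : ∀ n, 1 ≤ n → ∀ᵐ ω ∂μ, (f (P.history n ω)).isSome →
    ∃ N, 1 ≤ N ∧ ((P.obs N ω).val n).isSome
  integrable : ∀ n, 1 ≤ n → ∀ y ∈ Y, Integrable (fun ω => loss (P.outcome n ω) y) μ
  minimizes : ∀ n, 1 ≤ n → ∀ y' ∈ Y, ∀ᵐ ω ∂μ, (f (P.history n ω)).isSome →
    (μ[fun ω => (f (P.history n ω)).elim 0 fun y => loss (P.outcome n ω) y | P.sigma n]) ω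
      ≤ (μ[fun ω => loss (P.outcome n ω) y' | P.sigma n]) ω

end Env

section Algorithm

variable {X : Type*} {E : Type*} [NormedAddCommGroup E] {Y : Set E}

/-- Both forecasters make a prediction and the predictions are more than `1 / m` apart, where
`1 / 0 = ∞`. -/
def Disagree (f f' : Forecaster X Y) (m : ℕ) (o : List (Observation X)) : Prop :=
  ∃ y y' : Y, f o = some y ∧ f' o = some y' ∧ 0 < m ∧ 1 / (m : ℝ) < ‖(y : E) - (y' : E)‖

/-- State of the procedure `TestSeq`: the list of outputs so far, and the time `t` of the
prediction whose feedback is being waited for (`none` when not waiting). -/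
structure TestState where
  out : List ℕ
  waiting : Option ℕ

open Classical in
/-- State of `TestSeq` after the first `k` rounds of its loop, on the observations `o`. In round
`k`, if the procedure waits for feedback on `t` and `o_k` reveals the `t`-th outcome, then `t` is
output and the procedure stops waiting; if it is not waiting and the two forecasters disagree by
more than `1 / m` on `o₁, …, o_k`, it starts waiting for feedback on `k`. -/
noncomputable def testState (f f' : Forecaster X Y) (m : ℕ) (o : List (Observation X)) :
    ℕ → TestState
  | 0 => ⟨[], none⟩
  | k + 1 =>
    let st := testState f f' m o k
    match st.waiting with
    | some t =>
      if ∃ a, o[k]? = some a ∧ (a.val t).isSome then ⟨st.out ++ [t], none⟩ else st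
    | none =>
      if Disagree f f' m (o.take (k + 1)) then ⟨st.out, some (k + 1)⟩ else st

/-- After `k` rounds, `TestSeq` has output at most `k` times, all at most `k`. -/
theorem testState_le (f f' : Forecaster X Y) (m : ℕ) (o : List (Observation X)) (k : ℕ) :
    (testState f f' m o k).out.length ≤ k ∧ (∀ s ∈ (testState f f' m o k).out, s ≤ k) ∧
      ∀ t, (testState f f' m o k).waiting = some t → t ≤ k := by
  induction k with
  | zero => simp [testState]
  | succ k ih =>
    obtain ⟨h1, h2, h3⟩ := ih
    simp only [testState]
    split
    · rename_i t ht
      have := h3 t ht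
      split
      · refine ⟨by simpa using h1, ?_, by simp⟩
        intro s hs
        rcases List.mem_append.1 hs with hs | hs
        · exact (h2 s hs).trans (Nat.le_succ k)
        · simp at hs; omega
      · exact ⟨by omega, fun s hs => (h2 s hs).trans (Nat.le_succ k),
          fun t ht => (h3 t ht).trans (Nat.le_succ k)⟩
    · split
      · refine ⟨by simpa using h1.trans (Nat.le_succ k),
          fun s hs => (h2 s hs).trans (Nat.le_succ k), ?_⟩
        intro t ht
        simp at ht; omega
      · exact ⟨by omega, fun s hs => (h2 s hs).trans (Nat.le_succ k),
          fun t ht => (h3 t ht).trans (Nat.le_succ k)⟩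

/-- `TestSeq`: a greedily constructed independent sequence of times at which the two forecasters
disagree by more than `1 / m`. -/
noncomputable def testSeq (f f' : Forecaster X Y) (m : ℕ) (o : List (Observation X)) : List ℕ :=
  (testState f f' m o o.length).out

/-- The contribution of time `s` to the relative score. (On the elements of `testSeq` the three
values are always defined.) -/
noncomputable def scoreTerm (loss : X → E → ℝ) (ρ ε : ℝ) (f f' : Forecaster X Y) (m : ℕ)
    (o : List (Observation X)) (s : ℕ) : ℝ :=
  match revealed o s, f (o.take s), f' (o.take s) with
  | some x, some y, some y' => loss x y - loss x y' - ρ * ε / (2 * (m : ℝ) ^ 2)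
  | _, _, _ => 0

/-- `RelScore`: difference between the losses of two forecasters on their test sequence,
biased by `ρ ε / (2 m ^ 2)` per term. -/
noncomputable def relScore (loss : X → E → ℝ) (ρ ε : ℝ) (f f' : Forecaster X Y) (m : ℕ)
    (o : List (Observation X)) : ℝ :=
  ((testSeq f f' m o).map (scoreTerm loss ρ ε f f' m o)).sum

/-- `MaxScore`: the worst score of the `i`-th forecaster against the others,
`max_{j, m} (i - j - m + RelScore(i, j, m))`. -/
noncomputable def maxScore {K : ℕ} (loss : X → E → ℝ) (ρ ε : ℝ) (F : Fin K → Forecaster X Y)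
    (i : Fin K) (o : List (Observation X)) : ℝ :=
  ⨆ jm : Fin K × ℕ,
    ((i : ℝ) - (jm.1 : ℝ) - (jm.2 : ℝ) + relScore loss ρ ε (F i) (F jm.1) jm.2 o)

/-- The scores over which the maximum is taken are bounded above. -/
theorem bddAbove_scores {K : ℕ} (loss : X → E → ℝ) {ρ ε : ℝ} (hρ : 0 ≤ ρ) (hε : 0 ≤ ε)
    (F : Fin K → Forecaster X Y) (i : Fin K) (o : List (Observation X)) :
    BddAbove (Set.range fun jm : Fin K × ℕ =>
      ((i : ℝ) - (jm.1 : ℝ) - (jm.2 : ℝ) + relScore loss ρ ε (F i) (F jm.1) jm.2 o)) := by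
  set B : ℝ := ∑ j : Fin K, ∑ s ∈ Finset.range (o.length + 1),
    |scoreTerm loss 0 0 (F i) (F j) 0 o s| with hB
  have hB0 : 0 ≤ B := Finset.sum_nonneg fun j _ => Finset.sum_nonneg fun s _ => abs_nonneg _
  have hterm : ∀ (j : Fin K) (m s : ℕ), s ≤ o.length →
      scoreTerm loss ρ ε (F i) (F j) m o s ≤ B := by
    intro j m s hs
    have h1 : |scoreTerm loss 0 0 (F i) (F j) 0 o s| ≤ B :=
      (Finset.single_le_sum (f := fun s => |scoreTerm loss 0 0 (F i) (F j) 0 o s|)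
        (fun s _ => abs_nonneg _) (Finset.mem_range.2 (Nat.lt_succ_of_le hs))).trans
      (Finset.single_le_sum (f := fun j => ∑ s ∈ Finset.range (o.length + 1),
        |scoreTerm loss 0 0 (F i) (F j) 0 o s|)
        (fun j _ => Finset.sum_nonneg fun s _ => abs_nonneg _) (Finset.mem_univ j))
    refine le_trans ?_ ((le_abs_self _).trans h1)
    have h2 : 0 ≤ ρ * ε / (2 * (m : ℝ) ^ 2) := by positivity
    unfold scoreTerm
    split <;> simp [h2]
  refine ⟨(i : ℝ) + o.length * B, ?_⟩
  rintro _ ⟨⟨j, m⟩, rfl⟩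
  have h := testState_le (F i) (F j) m o o.length
  have h1 : relScore loss ρ ε (F i) (F j) m o ≤
      ((testSeq (F i) (F j) m o).map (scoreTerm loss ρ ε (F i) (F j) m o)).length • B := by
    refine List.sum_le_card_nsmul _ _ ?_
    intro x hx
    obtain ⟨s, hs, rfl⟩ := List.mem_map.1 hx
    exact hterm j m s (h.2.1 s hs)
  have h3 : ((testSeq (F i) (F j) m o).length : ℝ) ≤ o.length := by exact_mod_cast h.1
  rw [List.length_map, nsmul_eq_mul] at h1
  have h4 := mul_le_mul_of_nonneg_right h3 hB0
  have h5 : (0 : ℝ) ≤ (j : ℕ) := Nat.cast_nonneg _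
  have h6 : (0 : ℝ) ≤ m := Nat.cast_nonneg _
  show (i : ℝ) - (j : ℝ) - (m : ℝ) + _ ≤ _
  linarith

open Classical in
/-- The algorithm `EvOp`: among the forecasters that make a prediction on the given observations,
follow one whose `MaxScore` is minimal (the first such one). -/
noncomputable def evOp {K : ℕ} (loss : X → E → ℝ) (ρ ε : ℝ) (F : Fin K → Forecaster X Y) :
    Forecaster X Y :=
  fun o =>
    (((List.finRange K).filter fun i => (F i o).isSome).argmin
      fun i => maxScore loss ρ ε F i o).bind fun i => F i o

end Algorithm

end UnboundedDelay

/-! Strong convexity makes a Bayes-optimal prediction better, in conditional expectation, than any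
prediction at distance `δ` from it by at least `ρδ²/2`, while the Lipschitz bound keeps the loss
difference below `κδ` in absolute value. Hence for small `l` the conditional exponential moment of
`l` times (loss of `f_z` minus loss of `f_j`) is at most `1 - l(ρ/2 - lκ²)δ²`. When `δ > 1/m` and `ε
< 1`, this leaves room beyond the bias `ρε/(2m²)` in `RelScore` (`exp_mul_add_le`,
`IsBayesOptimal.integral_mul_exp_le`).

`TestSeq` never has two tests open at once. If each factor is counted when its prediction is made,
the product of these exponential factors is therefore a nonnegative supermartingale in effect,
however late the feedback, and a maximal inequality controls it for all `n` simultaneously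
(`IsBayesOptimal.measure_exists_expScore_ge_le`).

It is applied with two choices of the constant `c`. One shows that `RelScore(z,j,m') < a + m'` for
all `j`, `m'` and `n`, so `MaxScore(z) ≤ K + a`. The other shows that `RelScore(j,z,m)` exceeds `G ·
(number of outputs) - a`. The failure probabilities are summable over `m'` because of the penalty
`-m'`, and `a` is of order `1 + log(1/p)`. Once every test sequence against `f_z` has enough
outputs, no rival can have a score as small as that of `f_z` (`Environment.ConsistentAt.evOp_eq`).
Each application of `h ∘ g` leaves time for the open test to finish and another to start
(`Environment.exists_start_iterate`), which gives `N`. -/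

namespace UnboundedDelay

open MeasureTheory Filter Topology

/-! ### Measurability on options and lists. -/

section Option

variable {α β γ : Type*} [MeasurableSpace α] [MeasurableSpace β] [MeasurableSpace γ]

/-- The defining measurable equivalence of `Option α` with a disjoint union. -/
def optionMeasurableEquiv : Option α ≃ᵐ α ⊕ PUnit.{1} where
  toEquiv := Equiv.optionEquivSumPUnit.{0} α
  measurable_toFun := comap_measurable _
  measurable_invFun := by
    refine measurable_comap_iff.2 ?_
    convert measurable_id using 1
    funext s
    simp

theorem measurable_option_prod {f : Option α × γ → β}
    (hs : Measurable fun p : α × γ => f (some p.1, p.2))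
    (hn : Measurable fun c => f (none, c)) : Measurable f := by
  let e : Option α × γ ≃ᵐ (α × γ) ⊕ (PUnit.{1} × γ) :=
    (optionMeasurableEquiv.prodCongr (MeasurableEquiv.refl γ)).trans
      (MeasurableEquiv.sumProdDistrib α PUnit.{1} γ)
  have h : Measurable fun s => f (e.symm s) :=
    measurable_fun_sum hs (hn.comp measurable_snd)
  convert h.comp e.measurable using 1
  funext s
  simp

theorem measurable_option {f : Option α → β} (hs : Measurable fun a => f (some a)) :
    Measurable f :=
  (measurable_option_prod (f := fun p : Option α × Unit => f p.1) (hs.comp measurable_fst)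
    (by simp)).comp (measurable_id.prodMk (measurable_const (a := ())))

theorem measurable_some : Measurable (some : α → Option α) :=
  optionMeasurableEquiv.symm.measurable.comp measurable_inl

theorem measurable_isSome : Measurable (Option.isSome : Option α → Bool) :=
  measurable_option measurable_const

theorem measurableSet_isSome {f : γ → Option α} (hf : Measurable f) :
    MeasurableSet {c | (f c).isSome} :=
  measurable_isSome.comp hf (measurableSet_singleton true)

theorem measurable_getD (a : α) : Measurable fun o : Option α => o.getD a :=
  measurable_option measurable_id

end Option

section List

variable {α β : Type*} [MeasurableSpace α] [MeasurableSpace β]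

/-- The `σ`-algebra on lists for which measurability means measurability for each length. -/
instance listMeasurableSpace : MeasurableSpace (List α) :=
  ⨅ n : ℕ, MeasurableSpace.map (fun o : Fin n → α => List.ofFn o) inferInstance

theorem measurable_list_iff {f : List α → β} :
    Measurable f ↔ ∀ n : ℕ, Measurable fun o : Fin n → α => f (List.ofFn o) := by
  constructor
  · intro h n s hs
    exact (MeasurableSpace.measurableSet_iInf.1 (h hs)) n
  · intro h s hs
    exact MeasurableSpace.measurableSet_iInf.2 fun n => h n hs

theorem measurable_ofFn (n : ℕ) : Measurable fun o : Fin n → α => List.ofFn o :=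
  measurable_list_iff.1 measurable_id n

theorem measurable_list_take (k : ℕ) : Measurable fun l : List α => l.take k := by
  refine measurable_list_iff.2 fun n => ?_
  have : (fun o : Fin n → α => (List.ofFn o).take k) =
      fun o => List.ofFn fun i : Fin (min k n) => o (i.castLE (min_le_right _ _)) := by
    funext o
    refine List.ext_getElem (by simp) fun i h1 h2 => by simp
  rw [this]
  exact (measurable_ofFn _).comp (measurable_pi_lambda _ fun i => measurable_pi_apply _)

theorem measurable_list_getElem? (k : ℕ) : Measurable fun l : List α => l[k]? := by
  refine measurable_list_iff.2 fun n => ?_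
  by_cases hk : k < n
  · simpa [hk, Function.comp_def] using
      measurable_some.comp (measurable_pi_apply (⟨k, hk⟩ : Fin n))
  · simp [hk]

end List

/-! ### Measurability of the test procedure and its scores. -/

section Algorithm

variable {X : Type*} [MeasurableSpace X]

theorem measurable_val (n : ℕ) : Measurable fun a : Observation X => a.val n :=
  (measurable_pi_apply n).comp (comap_measurable _)

theorem measurable_revealed (s : ℕ) : Measurable fun o : List (Observation X) => revealed o s := by
  refine measurable_list_iff.2 fun n => ?_
  induction n with
  | zero => simp [revealed]
  | succ n ih =>
    have h : Measurable fun p : Option X × Option X => p.1.or p.2 :=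
      measurable_option_prod 
        (by simpa [Function.comp_def] using measurable_some.comp measurable_fst)
        (by simpa using measurable_id')
    have h2 : Measurable fun o : Fin (n + 1) → Observation X => fun i : Fin n => o i.succ :=
      measurable_pi_lambda _ fun i => measurable_pi_apply _
    convert h.comp (((measurable_val s).comp (measurable_pi_apply 0)).prodMk (ih.comp h2)) using 1
    funext o
    simp only [revealed, List.ofFn_succ, List.findSome?_cons, Function.comp]
    cases (o 0).val s <;> simp

theorem Forecaster.IsMeasurable.measurable {E : Type*} [MeasurableSpace E] {Y : Set E}
    {f : Forecaster X Y} (hf : f.IsMeasurable) : Measurable f :=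
  measurable_list_iff.2 hf

variable {E : Type*} [NormedAddCommGroup E] [MeasurableSpace E] [BorelSpace E]
  [SecondCountableTopology E] {Y : Set E}

theorem measurableSet_disagree {f f' : Forecaster X Y} (hf : f.IsMeasurable)
    (hf' : f'.IsMeasurable) (m : ℕ) : MeasurableSet {o | Disagree f f' m o} := by
  have h : Measurable fun p : Option Y × Option Y => ∃ y y' : Y,
      p.1 = some y ∧ p.2 = some y' ∧ 0 < m ∧ 1 / (m : ℝ) < ‖(y : E) - (y' : E)‖ := by
    refine measurable_option_prod ?_ (by simp)
    refine Measurable.comp (g := fun q : Option Y × Y => ∃ y y' : Y,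
      q.2 = y ∧ q.1 = some y' ∧ 0 < m ∧ 1 / (m : ℝ) < ‖(y : E) - (y' : E)‖)
      (f := Prod.swap) ?_ measurable_swap |> fun h => by simpa [Function.comp_def] using h
    refine measurable_option_prod ?_ (by simp)
    simp only [Option.some.injEq, exists_and_left, exists_eq_left']
    refine measurable_const.and (measurableSet_setOfPred.1 (measurableSet_lt measurable_const ?_))
    exact ((measurable_subtype_coe.comp measurable_snd).sub
      (measurable_subtype_coe.comp measurable_fst)).norm
  exact measurableSet_setOfPred.2 (h.comp (hf.measurable.prodMk hf'.measurable))

instance : MeasurableSpace TestState := ⊤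

instance : Countable TestState :=
  Function.Injective.countable (f := fun s : TestState => (s.out, s.waiting)) fun s t h => by
    cases s; cases t; simpa using h

theorem measurable_testState {f f' : Forecaster X Y} (hf : f.IsMeasurable)
    (hf' : f'.IsMeasurable) (m k : ℕ) :
    Measurable fun o : List (Observation X) => testState f f' m o k := by
  classical
  induction k with
  | zero => exact measurable_const
  | succ k ih =>
    have h : Measurable fun p : List (Observation X) × TestState =>
        (match p.2.waiting with
        | some t =>
          if ∃ a, p.1[k]? = some a ∧ (a.val t).isSome then ⟨p.2.out ++ [t], none⟩ else p.2
        | none => if Disagree f f' m (p.1.take (k + 1)) then ⟨p.2.out, some (k + 1)⟩ else p.2 :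
          TestState) := by
      -- There are only countably many test states, so joint measurability can be checked with the
      -- state held fixed.
      refine measurable_from_prod_countable_left fun st => ?_
      rcases st with ⟨l, _ | t⟩
      · exact Measurable.ite (measurable_list_take _ (measurableSet_disagree hf hf' m))
          (by simp) (by simp)
      · refine Measurable.ite ?_ (by simp) (by simp)
        have hb : Measurable fun o : List (Observation X) => (o[k]?).bind fun a => a.val t :=
          Measurable.comp (measurable_option (f := fun b : Option (Observation X) =>
            b.bind fun a => a.val t) (by simpa using measurable_val t))
            (measurable_list_getElem? k)
        convert measurableSet_isSome hb using 1
        ext o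
        simp [Option.isSome_iff_exists, Option.bind_eq_some_iff]
        tauto
    convert h.comp (measurable_id.prodMk ih) using 1
    funext o
    simp only [testState, Function.comp, id]

theorem measurable_loss {loss : X → E → ℝ} (hm : ∀ y ∈ Y, Measurable fun x => loss x y)
    (hc : ∀ x, ContinuousOn (loss x) Y) : Measurable fun p : X × Y => loss p.1 p.2 := by
  have := measurable_uncurry_of_continuous_of_measurable (u := fun (y : Y) (x : X) => loss x y)
    (fun x => continuousOn_iff_continuous_domRestrict.1 (hc x)) (fun y => hm y y.2)
  exact this.comp measurable_swap

theorem measurable_scoreTerm {loss : X → E → ℝ} (hm : ∀ y ∈ Y, Measurable fun x => loss x y)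
    (hc : ∀ x, ContinuousOn (loss x) Y) {f f' : Forecaster X Y} (hf : f.IsMeasurable)
    (hf' : f'.IsMeasurable) (ρ ε : ℝ) (m s : ℕ) :
    Measurable fun o : List (Observation X) => scoreTerm loss ρ ε f f' m o s := by
  have hl := measurable_loss hm hc
  have h : Measurable fun p : Option X × Option Y × Option Y =>
      (match p.1, p.2.1, p.2.2 with
      | some x, some y, some y' => loss x y - loss x y' - ρ * ε / (2 * (m : ℝ) ^ 2)
      | _, _, _ => 0 : ℝ) := by
    refine measurable_option_prod ?_ measurable_const
    suffices h : Measurable fun q : Option Y × X × Option Y =>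
        (match q.1, q.2.2 with
        | some y, some y' => loss q.2.1 y - loss q.2.1 y' - ρ * ε / (2 * (m : ℝ) ^ 2)
        | _, _ => 0 : ℝ) by
      convert h.comp (by fun_prop : Measurable fun p : X × Option Y × Option Y =>
        (p.2.1, p.1, p.2.2)) using 1
      funext ⟨x, y, y'⟩
      cases y <;> cases y' <;> rfl
    refine measurable_option_prod ?_ measurable_const
    suffices h : Measurable fun q : Option Y × X × Y =>
        (match q.1 with
        | some y' => loss q.2.1 q.2.2 - loss q.2.1 y' - ρ * ε / (2 * (m : ℝ) ^ 2)
        | _ => 0 : ℝ) by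
      convert h.comp (by fun_prop : Measurable fun p : Y × X × Option Y =>
        (p.2.2, p.2.1, p.1)) using 1
      funext ⟨y, x, y'⟩
      cases y' <;> rfl
    refine measurable_option_prod ?_ measurable_const
    exact ((hl.comp (by fun_prop : Measurable fun p : Y × X × Y => (p.2.1, p.2.2))).sub
      (hl.comp (by fun_prop : Measurable fun p : Y × X × Y => (p.2.1, p.1)))).sub_const _
  exact h.comp ((measurable_revealed s).prodMk
    ((hf.measurable.comp (measurable_list_take s)).prodMk
      (hf'.measurable.comp (measurable_list_take s))))

variable {Ω : Type*} [MeasurableSpace Ω] {μ : Measure Ω}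

theorem Environment.measurable_history (P : Environment X μ) (n : ℕ) :
    Measurable[P.sigma n] (P.history n) :=
  (measurable_ofFn n).comp (comap_measurable _)

theorem Environment.sigma_le (P : Environment X μ) (n : ℕ) :
    P.sigma n ≤ (inferInstance : MeasurableSpace Ω) :=
  (measurable_pi_lambda _ fun _ => P.measurable_obs _).comap_le

end Algorithm

/-! ### Prefixes, symmetry and invariants of `TestSeq`. -/

section Lists

variable {X : Type*} {E : Type*} [NormedAddCommGroup E] {Y : Set E}

theorem testState_take (f f' : Forecaster X Y) (m : ℕ) (o : List (Observation X)) {k n : ℕ}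
    (h : k ≤ n) : testState f f' m (o.take n) k = testState f f' m o k := by
  induction k with
  | zero => rfl
  | succ k ih =>
    have hd : Disagree f f' m ((o.take n).take (k + 1)) ↔ Disagree f f' m (o.take (k + 1)) := by
      rw [List.take_take, min_eq_left h]
    simp only [testState, ih (by omega), List.getElem?_take_of_lt (show k < n by omega)]
    by_cases h : Disagree f f' m (o.take (k + 1)) <;> simp [h, hd]

theorem disagree_comm (f f' : Forecaster X Y) (m : ℕ) (o : List (Observation X)) :
    Disagree f f' m o ↔ Disagree f' f m o := by
  constructor <;>
  · rintro ⟨y, y', h1, h2, h3, h4⟩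
    exact ⟨y', y, h2, h1, h3, by rwa [norm_sub_rev]⟩

/-- Disagreement is symmetric, so a single run of the procedure serves both `RelScore(i,j,m)` and
`RelScore(j,i,m)`. -/
theorem testState_comm (f f' : Forecaster X Y) (m : ℕ) (o : List (Observation X)) (k : ℕ) :
    testState f f' m o k = testState f' f m o k := by
  induction k with
  | zero => rfl
  | succ k ih => 
    have hd := disagree_comm f f' m (o.take (k + 1))
    simp only [testState, ih]
    by_cases h : Disagree f' f m (o.take (k + 1)) <;> simp [h, hd]

theorem testState_spec (f f' : Forecaster X Y) (m : ℕ) (o : List (Observation X)) (k : ℕ) :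
    (∀ s ∈ (testState f f' m o k).out, 1 ≤ s ∧ s ≤ k ∧ Disagree f f' m (o.take s) ∧
      (revealed o s).isSome) ∧
      ∀ t, (testState f f' m o k).waiting = some t →
        1 ≤ t ∧ t ≤ k ∧ Disagree f f' m (o.take t) := by
  induction k with
  | zero => simp [testState]
  | succ k ih =>
    obtain ⟨h1, h2⟩ := ih
    have h1' : ∀ s ∈ (testState f f' m o k).out, 1 ≤ s ∧ s ≤ k + 1 ∧
        Disagree f f' m (o.take s) ∧ (revealed o s).isSome := fun s hs =>
      ⟨(h1 s hs).1, (h1 s hs).2.1.trans (Nat.le_succ k), (h1 s hs).2.2⟩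
    have h2' : ∀ t, (testState f f' m o k).waiting = some t →
        1 ≤ t ∧ t ≤ k + 1 ∧ Disagree f f' m (o.take t) := fun t ht =>
      ⟨(h2 t ht).1, (h2 t ht).2.1.trans (Nat.le_succ k), (h2 t ht).2.2⟩
    simp only [testState]
    split
    · rename_i t ht
      split
      · rename_i hr
        refine ⟨fun s hs => ?_, by simp⟩
        rcases List.mem_append.1 hs with hs | hs
        · exact h1' s hs
        · obtain rfl := List.mem_singleton.1 hs
          obtain ⟨a, ha, hav⟩ := hr
          refine ⟨(h2' s ht).1, (h2' s ht).2.1, (h2' s ht).2.2, ?_⟩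
          exact List.findSome?_isSome_iff.2 ⟨a, List.mem_of_getElem? ha, hav⟩
      · exact ⟨h1', h2'⟩
    · split
      · rename_i hd
        refine ⟨h1', fun t ht => ?_⟩
        obtain rfl : k + 1 = t := by simpa using ht
        exact ⟨by omega, le_rfl, hd⟩
      · exact ⟨h1', h2'⟩

end Lists

/-! ### The test procedure along a sample path. -/

section States

variable {X : Type*} [MeasurableSpace X] {Ω : Type*} [MeasurableSpace Ω] {μ : Measure Ω}
  (P : Environment X μ)

theorem Environment.length_history (n : ℕ) (ω : Ω) : (P.history n ω).length = n := by
  simp [Environment.history]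

theorem Environment.history_getElem? {k n : ℕ} (h : k < n) (ω : Ω) :
    (P.history n ω)[k]? = some (P.obs (k + 1) ω) := by
  simp [Environment.history, Environment.obsTuple, h]

theorem Environment.take_history {k n : ℕ} (h : k ≤ n) (ω : Ω) :
    (P.history n ω).take k = P.history k ω := by
  refine List.ext_getElem (by simp [P.length_history, h]) fun i h1 h2 => ?_
  simp [Environment.history, Environment.obsTuple]

/-- All revealed values agree with the outcomes. -/
def Environment.ConsistentAt (ω : Ω) : Prop :=
  ∀ i n, 1 ≤ i → 1 ≤ n → ∀ x, (P.obs i ω).val n = some x → P.outcome n ω = x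

theorem Environment.ae_consistentAt : ∀ᵐ ω ∂μ, P.ConsistentAt ω := by
  simp only [Environment.ConsistentAt, ae_all_iff]
  intro i n hi hn
  simpa only [ae_all_iff] using P.consistent i n hi hn

variable {P} in
theorem Environment.ConsistentAt.revealed_eq {ω : Ω} (hω : P.ConsistentAt ω) {n s : ℕ} {x : X}
    (hs : 1 ≤ s) (h : revealed (P.history n ω) s = some x) : P.outcome s ω = x := by
  obtain ⟨a, ha, hx⟩ := List.exists_of_findSome?_eq_some h
  obtain ⟨k, hk, rfl⟩ := List.mem_iff_getElem.1 ha
  refine hω (k + 1) s (by omega) hs x ?_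
  simpa [Environment.history, Environment.obsTuple] using hx

variable {E : Type*} {Y : Set E}

/-- The difference between the losses of two forecasters on the outcome with index `s`. -/
noncomputable def Environment.lossDiff (loss : X → E → ℝ) (f f' : Forecaster X Y) (s : ℕ)
    (ω : Ω) : ℝ :=
  match f (P.history s ω), f' (P.history s ω) with
  | some y, some y' => loss (P.outcome s ω) y - loss (P.outcome s ω) y'
  | _, _ => 0

theorem Environment.lossDiff_comm (loss : X → E → ℝ) (f f' : Forecaster X Y) (s : ℕ) (ω : Ω) :
    P.lossDiff loss f' f s ω = - P.lossDiff loss f f' s ω := by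
  unfold Environment.lossDiff
  cases f (P.history s ω) <;> cases f' (P.history s ω) <;> simp

variable [NormedAddCommGroup E]

/-- The state of `TestSeq` after `n` rounds on the observations of the environment. -/
noncomputable def Environment.state (f f' : Forecaster X Y) (m n : ℕ) (ω : Ω) : TestState :=
  testState f f' m (P.history n ω) n

open Classical in
theorem Environment.state_succ (f f' : Forecaster X Y) (m n : ℕ) (ω : Ω) :
    P.state f f' m (n + 1) ω = match (P.state f f' m n ω).waiting with
    | some t => if ((P.obs (n + 1) ω).val t).isSome then
        ⟨(P.state f f' m n ω).out ++ [t], none⟩ else P.state f f' m n ω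
    | none => if Disagree f f' m (P.history (n + 1) ω) then
        ⟨(P.state f f' m n ω).out, some (n + 1)⟩ else P.state f f' m n ω := by
  have h : testState f f' m (P.history (n + 1) ω) n = P.state f f' m n ω := by
    rw [Environment.state, ← P.take_history n.le_succ, testState_take _ _ _ _ le_rfl]
  rw [Environment.state]
  simp only [testState, h, P.history_getElem? n.lt_succ_self, P.take_history le_rfl]
  cases (P.state f f' m n ω).waiting <;> simp

theorem Environment.testSeq_history (f f' : Forecaster X Y) (m n : ℕ) (ω : Ω) :
    testSeq f f' m (P.history n ω) = (P.state f f' m n ω).out := by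
  rw [testSeq, P.length_history, Environment.state]

theorem Environment.state_spec (f f' : Forecaster X Y) (m n : ℕ) (ω : Ω) :
    (∀ s ∈ (P.state f f' m n ω).out, 1 ≤ s ∧ s ≤ n ∧ Disagree f f' m (P.history s ω) ∧
      (revealed (P.history n ω) s).isSome) ∧
      ∀ t, (P.state f f' m n ω).waiting = some t →
        1 ≤ t ∧ t ≤ n ∧ Disagree f f' m (P.history t ω) := by
  obtain ⟨h1, h2⟩ := testState_spec f f' m (P.history n ω) n
  refine ⟨fun s hs => ?_, fun t ht => ?_⟩
  · have := h1 s hs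
    rwa [P.take_history this.2.1] at this
  · have := h2 t ht
    rwa [P.take_history this.2.1] at this

variable {P} in
theorem Environment.ConsistentAt.scoreTerm_eq {ω : Ω} (hω : P.ConsistentAt ω)
    (loss : X → E → ℝ) (ρ ε : ℝ) (f f' : Forecaster X Y) (m m' : ℕ) {n s : ℕ} (hs : 1 ≤ s)
    (hsn : s ≤ n) (hd : Disagree f f' m (P.history s ω))
    (hr : (revealed (P.history n ω) s).isSome) :
    scoreTerm loss ρ ε f f' m' (P.history n ω) s =
      P.lossDiff loss f f' s ω - ρ * ε / (2 * (m' : ℝ) ^ 2) := by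
  obtain ⟨y, y', h1, h2, -⟩ := hd
  obtain ⟨x, hx⟩ := Option.isSome_iff_exists.1 hr
  simp [scoreTerm, Environment.lossDiff, P.take_history hsn, h1, h2, hx, hω.revealed_eq hs hx]

variable {P} in
theorem Environment.ConsistentAt.relScore_eq {ω : Ω} (hω : P.ConsistentAt ω)
    (loss : X → E → ℝ) (ρ ε : ℝ) (f f' : Forecaster X Y) (m n : ℕ) :
    relScore loss ρ ε f f' m (P.history n ω) = ((P.state f f' m n ω).out.map fun s =>
      P.lossDiff loss f f' s ω - ρ * ε / (2 * (m : ℝ) ^ 2)).sum := by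
  rw [relScore, P.testSeq_history]
  congr 1
  refine List.map_congr_left fun s hs => ?_
  obtain ⟨h1, h2, h3, h4⟩ := (P.state_spec f f' m n ω).1 s hs
  exact hω.scoreTerm_eq loss ρ ε f f' m m h1 h2 h3 h4

theorem Environment.state_comm (f f' : Forecaster X Y) (m n : ℕ) (ω : Ω) :
    P.state f f' m n ω = P.state f' f m n ω :=
  testState_comm _ _ _ _ _

/-! ### The number of outputs of `TestSeq` -/

theorem Environment.length_out_mono (f f' : Forecaster X Y) (m : ℕ) (ω : Ω) :
    Monotone fun n => (P.state f f' m n ω).out.length := by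
  refine monotone_nat_of_le_succ fun n => ?_
  rw [P.state_succ]
  split <;> split <;> simp

variable {f f' : Forecaster X Y} {m : ℕ} {ω : Ω}

/-- A procedure that never starts up to time `t` is still idle in round `t`, and the disagreement
there makes it start. Waiting for `s` after exactly `s` rounds encodes that the test was started at
`s`. -/
theorem Environment.exists_start {k t : ℕ} (hk : (P.state f f' m k ω).waiting = none)
    (hkt : k < t) (ht : Disagree f f' m (P.history t ω)) :
    ∃ s, k < s ∧ s ≤ t ∧ (P.state f f' m s ω).waiting = some s := by
  classical
  by_contra hcon
  push Not at hcon
  have h : ∀ n, k ≤ n → n ≤ t → (P.state f f' m n ω).waiting = none := by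
    intro n hn
    induction n, hn using Nat.le_induction with
    | base => exact fun _ => hk
    | succ n hn ih =>
      intro hnt
      have := hcon (n + 1) (by omega) hnt
      rw [P.state_succ, ih (by omega)] at this ⊢
      dsimp only at this ⊢
      split_ifs at this ⊢ <;> simp_all [ih (Nat.le_of_lt hnt)]
  obtain ⟨n, rfl⟩ : ∃ n, t = n + 1 := ⟨t - 1, by omega⟩
  have := hcon (n + 1) hkt le_rfl
  rw [P.state_succ, h n (by omega) (by omega)] at this
  simp [ht] at this

/-- The output may come before round `k`, since an earlier observation may already reveal outcome
`t`. The inequality `t < k` is essential: the round that starts a test does not look for its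
feedback. -/
theorem Environment.exists_output {k t : ℕ} (hk : (P.state f f' m t ω).waiting = some t)
    (htk : t < k) (ht : ((P.obs k ω).val t).isSome) :
    ∃ s, t < s ∧ s ≤ k ∧ (P.state f f' m s ω).waiting = none ∧
      (P.state f f' m t ω).out.length + 1 ≤ (P.state f f' m s ω).out.length := by
  classical
  by_contra hcon
  push Not at hcon
  have h : ∀ n, t ≤ n → n ≤ k → (P.state f f' m n ω).waiting = some t := by
    intro n hn
    induction n, hn using Nat.le_induction with
    | base => exact fun _ => hk
    | succ n hn ih =>
      intro hnt
      have h1 := hcon (n + 1) (by omega) hnt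
      have h2 := P.length_out_mono f f' m ω hn
      dsimp only at h2
      rw [P.state_succ, ih (by omega)] at h1 ⊢
      dsimp only at h1 ⊢
      split
      · rename_i h3
        simp [h3] at h1
        omega
      · exact ih (by omega)
  obtain ⟨n, rfl⟩ : ∃ n, k = n + 1 := ⟨k - 1, by omega⟩
  have h1 := hcon (n + 1) htk le_rfl
  have h2 := P.length_out_mono f f' m ω (show t ≤ n by omega)
  dsimp only at h2
  rw [P.state_succ, h n (by omega) (by omega)] at h1
  simp [ht] at h1
  omega

/-- An open test at `t` is finished by some `s ≤ g t`, and the next disagreement occurs before `h s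
≤ h (g t)`. So one application of `h ∘ g` bounds the time from one start to the next. -/
theorem Environment.exists_start_iterate {h g : ℕ → ℕ} (hh : Monotone h) (hg : Monotone g)
    (ha : ∀ t, 1 ≤ t → ∃ t', t < t' ∧ t' < h t ∧ Disagree f f' m (P.history t' ω))
    (hb : ∀ t, 1 ≤ t → ∃ k, t < k ∧ k ≤ g t ∧ ((P.obs k ω).val t).isSome) (r : ℕ) :
    ∃ t, 1 ≤ t ∧ t ≤ (h ∘ g)^[r + 1] 1 ∧ (P.state f f' m t ω).waiting = some t ∧
      r ≤ (P.state f f' m t ω).out.length := by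
  induction r with
  | zero =>
    obtain ⟨t', h1, h2, h3⟩ := ha 1 le_rfl
    obtain ⟨k, h4, h5, -⟩ := hb 1 le_rfl
    have h6 : h 1 ≤ h (g 1) := hh (by omega)
    obtain ⟨s, hs1, hs2, hs3⟩ := P.exists_start (f := f) (f' := f') (m := m) (k := 0) rfl
      (by omega) h3
    exact ⟨s, by omega, by simp; omega, hs3, Nat.zero_le _⟩
  | succ r ih =>
    obtain ⟨t, h1, h2, h3, h4⟩ := ih
    obtain ⟨k, hk1, hk2, hk3⟩ := hb t h1
    obtain ⟨s, hs1, hs2, hs3, hs4⟩ := P.exists_output h3 hk1 hk3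
    obtain ⟨t', ht1, ht2, ht3⟩ := ha s (by omega)
    obtain ⟨u, hu1, hu2, hu3⟩ := P.exists_start hs3 ht1 ht3
    refine ⟨u, by omega, ?_, hu3, ?_⟩
    · rw [Function.iterate_succ_apply']
      have h5 : h s ≤ h (g ((h ∘ g)^[r + 1] 1)) := hh ((hs2.trans hk2).trans (hg h2))
      simp only [Function.comp_apply] at h5 ⊢
      omega
    · have := P.length_out_mono f f' m ω hu1.le
      dsimp only at this
      omega

theorem Environment.le_length_out {h g : ℕ → ℕ} (hh : Monotone h) (hg : Monotone g)
    (ha : ∀ t, 1 ≤ t → ∃ t', t < t' ∧ t' < h t ∧ Disagree f f' m (P.history t' ω))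
    (hb : ∀ t, 1 ≤ t → ∃ k, t < k ∧ k ≤ g t ∧ ((P.obs k ω).val t).isSome) {r n : ℕ}
    (hn : (h ∘ g)^[r] 1 ≤ n) : r ≤ (P.state f f' m n ω).out.length + 1 := by
  -- The test started last may still be open, which costs one output.
  rcases r with _ | r
  · omega
  · obtain ⟨t, -, h2, -, h4⟩ := P.exists_start_iterate hh hg ha hb r
    have := P.length_out_mono f f' m ω (h2.trans hn)
    dsimp only at this
    omega

end States

/-! ### Strong convexity together with the Lipschitz condition bounds `Y` and the loss differences.
-/

section Loss

variable {E : Type*} [NormedAddCommGroup E] [NormedSpace ℝ E] {Y : Set E} {ρ : ℝ} {κ : NNReal}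

/-- At the midpoint, strong convexity gains `ρ/8 · ‖y - y'‖²` over the average of the end values,
whereas the Lipschitz condition allows a drop of at most `κ/2 · ‖y - y'‖`. -/
theorem mul_norm_sub_le_of_strongConvexOn {φ : E → ℝ} (hφ : StrongConvexOn Y ρ φ)
    (hl : LipschitzOnWith κ φ Y) {y y' : E} (hy : y ∈ Y) (hy' : y' ∈ Y) :
    ρ * ‖y - y'‖ ≤ 4 * κ := by
  obtain ⟨hc, h⟩ := hφ
  have h1 := h hy hy' (a := 1 / 2) (b := 1 / 2) (by norm_num) (by norm_num) (by norm_num)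
  have hm : (1 / 2 : ℝ) • y + (1 / 2 : ℝ) • y' ∈ Y :=
    hc hy hy' (by norm_num) (by norm_num) (by norm_num)
  have h2 := hl.dist_le_mul y hy _ hm
  have h3 := hl.dist_le_mul y' hy' _ hm
  have e1 : y - ((1 / 2 : ℝ) • y + (1 / 2 : ℝ) • y') = (1 / 2 : ℝ) • (y - y') := by module
  have e2 : y' - ((1 / 2 : ℝ) • y + (1 / 2 : ℝ) • y') = (1 / 2 : ℝ) • (y' - y) := by module
  rw [dist_eq_norm y, e1, norm_smul, Real.dist_eq] at h2
  rw [dist_eq_norm y', e2, norm_smul, Real.dist_eq, norm_sub_rev] at h3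
  have h4 := (le_abs_self _).trans h2
  have h5 := (le_abs_self _).trans h3
  norm_num at h1 h4 h5
  rcases (norm_nonneg (y - y')).eq_or_lt with h6 | h6
  · rw [← h6]; simp
  · refine le_of_mul_le_mul_right ?_ h6
    nlinarith

theorem abs_sub_le_of_strongConvexOn (hρ : 0 < ρ) {φ : E → ℝ} (hφ : StrongConvexOn Y ρ φ)
    (hl : LipschitzOnWith κ φ Y) {y y' : E} (hy : y ∈ Y) (hy' : y' ∈ Y) :
    |φ y - φ y'| ≤ κ * (4 * κ / ρ) := by
  have h := hl.dist_le_mul y hy y' hy'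
  rw [Real.dist_eq, dist_eq_norm] at h
  refine h.trans (mul_le_mul_of_nonneg_left ?_ κ.2)
  rw [le_div_iff₀ hρ, mul_comm]
  exact mul_norm_sub_le_of_strongConvexOn hφ hl hy hy'

end Loss

/-! ### Measurability of loss differences. -/

section Measurability

variable {X : Type*} [MeasurableSpace X] {Ω : Type*} [MeasurableSpace Ω] {μ : Measure Ω}
  {E : Type*} [NormedAddCommGroup E] [MeasurableSpace E] [BorelSpace E]
  [SecondCountableTopology E] {Y : Set E} {κ : NNReal} {loss : X → E → ℝ}
  {f f' : Forecaster X Y}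

theorem Environment.measurable_lossDiff (P : Environment X μ)
    (hm : ∀ y ∈ Y, Measurable fun x => loss x y) (hl : ∀ x, LipschitzOnWith κ (loss x) Y)
    (hf : f.IsMeasurable) (hf' : f'.IsMeasurable) (n : ℕ) :
    Measurable (P.lossDiff loss f f' n) := by
  have hL := measurable_loss hm fun x => (hl x).continuousOn
  have hfm := (hf.measurable.comp (P.measurable_history n)).mono (P.sigma_le n) le_rfl
  have hfm' := (hf'.measurable.comp (P.measurable_history n)).mono (P.sigma_le n) le_rfl
  rcases isEmpty_or_nonempty Y with hY | ⟨⟨y₀⟩⟩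
  · convert (measurable_const (a := (0 : ℝ))) using 1
    funext ω
    simp only [Environment.lossDiff]
    split
    · rename_i y _ _ _
      exact hY.elim y
    · rfl
  · have e : P.lossDiff loss f f' n = fun ω =>
        if (f (P.history n ω)).isSome ∧ (f' (P.history n ω)).isSome then
          loss (P.outcome n ω) ((f (P.history n ω)).getD y₀) -
            loss (P.outcome n ω) ((f' (P.history n ω)).getD y₀) else 0 := by
      funext ω
      simp only [Environment.lossDiff]
      cases f (P.history n ω) <;> cases f' (P.history n ω) <;> simp
    rw [e]
    refine Measurable.ite ((measurableSet_isSome hfm).inter (measurableSet_isSome hfm')) ?_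
      measurable_const
    exact (hL.comp ((P.measurable_outcome n).prodMk ((measurable_getD y₀).comp hfm))).sub
      (hL.comp ((P.measurable_outcome n).prodMk ((measurable_getD y₀).comp hfm')))

end Measurability

/-! ### From Bayes optimality to an exponential moment bound. -/

section Optimality

variable {X : Type*} [MeasurableSpace X] {Ω : Type*} [MeasurableSpace Ω] {μ : Measure Ω}
  {P : Environment X μ} {E : Type*} {Y : Set E} {ρ : ℝ} {κ : NNReal} {loss : X → E → ℝ}
  {f f' : Forecaster X Y}

/-- The weight `W` is known given the first `n` observations, so it can be pulled out of the
conditional expectations, which are then compared pointwise. -/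
theorem IsBayesOptimal.integral_mul_le [IsProbabilityMeasure μ]
    (hopt : IsBayesOptimal P loss f) {n : ℕ}
    (hn : 1 ≤ n)
    (hi : Integrable (fun ω => (f (P.history n ω)).elim 0 fun y => loss (P.outcome n ω) y) μ)
    {y : E} (hy : y ∈ Y) {W : Ω → ℝ} (hW : Measurable[P.sigma n] W) {b : ℝ}
    (hW0 : ∀ ω, 0 ≤ W ω) (hWb : ∀ ω, W ω ≤ b) (hWf : ∀ ω, W ω ≠ 0 → (f (P.history n ω)).isSome) :
    ∫ ω, W ω * ((f (P.history n ω)).elim 0 fun y => loss (P.outcome n ω) y) ∂μ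
      ≤ ∫ ω, W ω * loss (P.outcome n ω) y ∂μ := by
  have hbd : ∀ᵐ ω ∂μ, ‖W ω‖ ≤ b :=
    ae_of_all _ fun ω => by rw [Real.norm_of_nonneg (hW0 ω)]; exact hWb ω
  have hWm := (hW.mono (P.sigma_le n) le_rfl).aestronglyMeasurable (μ := μ)
  have key : ∀ {u : Ω → ℝ}, Integrable u μ →
      ∫ ω, W ω * u ω ∂μ = ∫ ω, W ω * (μ[u | P.sigma n]) ω ∂μ := fun {u} hu => by
    rw [← integral_condExp (P.sigma_le n)]
    exact integral_congr_ae
      (condExp_mul_of_stronglyMeasurable_left hW.stronglyMeasurable (hu.bdd_mul hWm hbd) hu)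
  rw [key hi, key (hopt.integrable n hn y hy)]
  refine integral_mono_ae (integrable_condExp.bdd_mul hWm hbd)
    (integrable_condExp.bdd_mul hWm hbd) ?_
  filter_upwards [hopt.minimizes n hn y hy] with ω hω
  by_cases h : W ω = 0
  · simp [h]
  · exact mul_le_mul_of_nonneg_left (hω (hWf ω h)) (hW0 ω)

variable [NormedAddCommGroup E] [NormedSpace ℝ E]

theorem Environment.abs_lossDiff_le (P : Environment X μ) (hρ : 0 < ρ)
    (hs : ∀ x, StrongConvexOn Y ρ (loss x)) (hl : ∀ x, LipschitzOnWith κ (loss x) Y) (n : ℕ)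
    (ω : Ω) : |P.lossDiff loss f f' n ω| ≤ κ * (4 * κ / ρ) := by
  unfold Environment.lossDiff
  split
  · exact abs_sub_le_of_strongConvexOn hρ (hs _) (hl _) (Subtype.coe_prop _) (Subtype.coe_prop _)
  · rw [abs_zero]
    positivity

/-- With `x = l(r/2 - lk²)δ²`, the bound `exp u ≤ 1 + u + u²` for `|u| ≤ 1` gives `exp(lD) ≤ 1 + l(D
+ rδ²/2) - x`. Since `c ≤ x`, also `exp c · (1 - x) ≤ exp(c - x) ≤ 1`. What remains beyond `1` is a
multiple of `D + rδ²/2`, whose weighted mean is nonpositive by optimality. -/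
theorem exp_mul_add_le {l r k c D δ q : ℝ} (hl : 0 ≤ l)
    (hlk : l * (k * δ) ≤ 1) (hD : |D| ≤ k * δ) (hq : q ≤ δ) (hq0 : 0 ≤ q)
    (hr : 0 ≤ r / 2 - l * k ^ 2) (hc : c ≤ l * (r / 2 - l * k ^ 2) * q ^ 2) :
    Real.exp (l * D + c) ≤ 1 + Real.exp c * l * (D + r / 2 * δ ^ 2) := by
  have h1 : |l * D| ≤ l * (k * δ) := by
    rw [abs_mul, abs_of_nonneg hl]; exact mul_le_mul_of_nonneg_left hD hl
  have h2 := (le_abs_self _).trans (Real.abs_exp_sub_one_sub_id_le (h1.trans hlk))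
  have h3 : (l * D) ^ 2 ≤ (l * (k * δ)) ^ 2 := sq_le_sq' (abs_le.1 h1).1 (abs_le.1 h1).2
  have h4 : Real.exp (l * D) ≤ 1 + l * (D + r / 2 * δ ^ 2) - l * (r / 2 - l * k ^ 2) * δ ^ 2 := by
    nlinarith
  have h5 : c ≤ l * (r / 2 - l * k ^ 2) * δ ^ 2 :=
    hc.trans (mul_le_mul_of_nonneg_left (pow_le_pow_left₀ hq0 hq 2) (mul_nonneg hl hr))
  have h6 : Real.exp c * (1 - l * (r / 2 - l * k ^ 2) * δ ^ 2) ≤ 1 := by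
    have h7 := Real.add_one_le_exp (-(l * (r / 2 - l * k ^ 2) * δ ^ 2))
    calc _ ≤ Real.exp c * Real.exp (-(l * (r / 2 - l * k ^ 2) * δ ^ 2)) :=
          mul_le_mul_of_nonneg_left (by linarith) (Real.exp_pos _).le
      _ ≤ 1 := by rw [← Real.exp_add, Real.exp_le_one_iff]; linarith
  rw [Real.exp_add, mul_comm]
  have h8 := mul_le_mul_of_nonneg_left h4 (Real.exp_pos c).le
  nlinarith

variable [MeasurableSpace E] [BorelSpace E] [SecondCountableTopology E]

/-- Optimality is almost sure for each fixed competitor only, with a null set depending on it. An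
observation-dependent competitor `V` is reached through finitely valued approximations from a dense
sequence and dominated convergence. -/
theorem IsBayesOptimal.integral_mul_sub_nonpos [IsProbabilityMeasure μ]
    (hopt : IsBayesOptimal P loss f) (hρ : 0 < ρ)
    (hm : ∀ y ∈ Y, Measurable fun x => loss x y) (hs : ∀ x, StrongConvexOn Y ρ (loss x))
    (hl : ∀ x, LipschitzOnWith κ (loss x) Y) {n : ℕ} (hn : 1 ≤ n) {U V : Ω → Y}
    (hU : Measurable[P.sigma n] U) (hV : Measurable[P.sigma n] V)
    {W : Ω → ℝ} (hW : Measurable[P.sigma n] W) {b : ℝ} (hW0 : ∀ ω, 0 ≤ W ω) (hWb : ∀ ω, W ω ≤ b)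
    (hWf : ∀ ω, W ω ≠ 0 → f (P.history n ω) = some (U ω)) (hf : f.IsMeasurable) :
    ∫ ω, W ω * (loss (P.outcome n ω) (U ω) - loss (P.outcome n ω) (V ω)) ∂μ ≤ 0 := by
  have hle := P.sigma_le n
  obtain ⟨ω₀⟩ : Nonempty Ω := nonempty_of_isProbabilityMeasure μ
  have : Nonempty Y := ⟨U ω₀⟩
  have hL := measurable_loss hm fun x => (hl x).continuousOn
  have hLm : ∀ {V : Ω → Y}, Measurable[P.sigma n] V →
      Measurable fun ω => loss (P.outcome n ω) (V ω) := fun {V} hV =>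
    hL.comp ((P.measurable_outcome n).prodMk (hV.mono hle le_rfl))
  have hbd : ∀ x, ∀ y y' : Y, |loss x y - loss x y'| ≤ κ * (4 * κ / ρ) := fun x y y' =>
    abs_sub_le_of_strongConvexOn hρ (hs x) (hl x) y.2 y'.2
  have hfU : ∀ ω, W ω ≠ 0 → ((f (P.history n ω)).elim 0 fun y => loss (P.outcome n ω) y) =
      loss (P.outcome n ω) (U ω) := fun ω h => by rw [hWf ω h]; rfl
  have hb0 : 0 ≤ b := (hW0 ω₀).trans (hWb ω₀)
  have hWm := (hW.mono hle le_rfl)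
  -- all integrands are bounded
  have hint : ∀ {W' : Ω → ℝ} {V : Ω → Y}, Measurable[P.sigma n] W' → (∀ ω, 0 ≤ W' ω) →
      (∀ ω, W' ω ≤ b) → Measurable[P.sigma n] V →
      Integrable (fun ω => W' ω * (loss (P.outcome n ω) (U ω) - loss (P.outcome n ω) (V ω))) μ := by
    intro W' V hW' h0 h1 hV
    refine Integrable.of_bound ((hW'.mono hle le_rfl).mul
      ((hLm hU).sub (hLm hV))).aestronglyMeasurable (b * (κ * (4 * κ / ρ))) (ae_of_all _ fun ω => ?_)
    rw [norm_mul, Real.norm_of_nonneg (h0 ω)]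
    exact mul_le_mul (h1 ω) (hbd _ _ _) (norm_nonneg _) hb0
  -- constant competitors
  have hconst : ∀ y : Y, ∀ {W' : Ω → ℝ}, Measurable[P.sigma n] W' → (∀ ω, 0 ≤ W' ω) →
      (∀ ω, W' ω ≤ b) → (∀ ω, W' ω ≠ 0 → W ω ≠ 0) →
      ∫ ω, W' ω * (loss (P.outcome n ω) (U ω) - loss (P.outcome n ω) y) ∂μ ≤ 0 := by
    intro y W' hW' h0 h1 hWW
    have hiy := hopt.integrable n hn y y.2
    have hfm : Measurable fun ω => f (P.history n ω) :=
      (hf.measurable.comp (P.measurable_history n)).mono hle le_rfl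
    have hi : Integrable (fun ω => (f (P.history n ω)).elim 0 fun y => loss (P.outcome n ω) y) μ := by
      refine (hiy.norm.add (integrable_const (κ * (4 * κ / ρ) : ℝ))).mono' ?_
        (ae_of_all _ fun ω => ?_)
      · refine Measurable.aestronglyMeasurable ?_
        refine Measurable.comp (g := fun p : Option Y × X => p.1.elim 0 fun y => loss p.2 y)
          (measurable_option_prod ?_ (by simp)) (hfm.prodMk (P.measurable_outcome n))
        exact hL.comp measurable_swap
      · cases h : f (P.history n ω) with
        | none =>
          simp only [Option.elim, norm_zero, Pi.add_apply]
          have := (abs_nonneg _).trans (hbd (P.outcome n ω) y y)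
          positivity
        | some v =>
          have h2 := hbd (P.outcome n ω) v y
          simp only [Option.elim, Pi.add_apply, Real.norm_eq_abs]
          have := abs_add_le (loss (P.outcome n ω) y) (loss (P.outcome n ω) v - loss (P.outcome n ω) y)
          rw [add_sub_cancel] at this
          linarith
    have hopt' := hopt.integral_mul_le hn hi y.2 hW' h0 h1 fun ω h => by
      rw [hWf ω (hWW ω h)]; rfl
    have e : ∀ ω, W' ω * (loss (P.outcome n ω) (U ω) - loss (P.outcome n ω) y) =
        W' ω * ((f (P.history n ω)).elim 0 fun y => loss (P.outcome n ω) y) -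
          W' ω * loss (P.outcome n ω) y := by
      intro ω
      by_cases h : W' ω = 0
      · simp [h]
      · rw [hfU ω (hWW ω h), mul_sub]
    have hWm' := (hW'.mono hle le_rfl).aestronglyMeasurable (μ := μ)
    have hbd' : ∀ᵐ ω ∂μ, ‖W' ω‖ ≤ b :=
      ae_of_all _ fun ω => by rw [Real.norm_of_nonneg (h0 ω)]; exact h1 ω
    rw [integral_congr_ae (ae_of_all _ e), integral_sub (hi.bdd_mul hWm' hbd')
      (hiy.bdd_mul hWm' hbd')]
    linarith
  -- competitors with finitely many values
  let e := TopologicalSpace.denseSeq Y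
  have hsimple : ∀ N : ℕ, ∫ ω, W ω * (loss (P.outcome n ω) (U ω) -
      loss (P.outcome n ω) (SimpleFunc.nearestPt e N (V ω))) ∂μ ≤ 0 := by
    intro N
    let I : Ω → ℕ := fun ω => SimpleFunc.nearestPtInd e N (V ω)
    have hI : Measurable[P.sigma n] I := (SimpleFunc.measurable _).comp hV
    -- Localizing the weight to the event that the `k`-th dense point is chosen reduces each piece
    -- to a constant competitor.
    let W' : ℕ → Ω → ℝ := fun k ω => if I ω = k then W ω else 0
    have hWk : ∀ k, Measurable[P.sigma n] (W' k) := fun k =>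
      Measurable.ite (hI (measurableSet_singleton k)) hW measurable_const
    have h0 : ∀ k ω, 0 ≤ W' k ω := fun k ω => by dsimp only [W']; split_ifs; exacts [hW0 ω, le_rfl]
    have h1 : ∀ k ω, W' k ω ≤ b := fun k ω => by dsimp only [W']; split_ifs; exacts [hWb ω, hb0]
    have hsum : ∀ ω, W ω * (loss (P.outcome n ω) (U ω) -
        loss (P.outcome n ω) (SimpleFunc.nearestPt e N (V ω))) =
        ∑ k ∈ Finset.range (N + 1), W' k ω * (loss (P.outcome n ω) (U ω) -
          loss (P.outcome n ω) (e k)) := by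
      intro ω
      rw [Finset.sum_eq_single (I ω)]
      · simp [W', I, SimpleFunc.nearestPt]
      · intro k _ hk
        simp [W', hk.symm]
      · intro hk
        exact absurd (Finset.mem_range.2 (Nat.lt_succ_of_le (SimpleFunc.nearestPtInd_le e N (V ω)))) hk
    rw [integral_congr_ae (ae_of_all _ hsum), integral_finsetSum _ fun k _ =>
      hint (hWk k) (h0 k) (h1 k) measurable_const]
    refine Finset.sum_nonpos fun k _ => hconst (e k) (hWk k) (h0 k) (h1 k) fun ω h h' => h ?_
    simp [W', h']
  refine le_of_tendsto' (tendsto_integral_of_dominated_convergence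
    (fun _ => b * (κ * (4 * κ / ρ))) (fun N => ?_) (integrable_const _)
    (fun N => ae_of_all _ fun ω => ?_) (ae_of_all _ fun ω => ?_)) hsimple
  · exact (hWm.mul ((hLm hU).sub
      (hLm ((SimpleFunc.measurable _).comp hV)))).aestronglyMeasurable
  · rw [norm_mul, Real.norm_of_nonneg (hW0 ω)]
    exact mul_le_mul (hWb ω) (hbd _ _ _) (norm_nonneg _) hb0
  · have h1 : Tendsto (fun N => SimpleFunc.nearestPt e N (V ω)) atTop (𝓝 (V ω)) :=
      SimpleFunc.tendsto_nearestPt (TopologicalSpace.denseRange_denseSeq Y (V ω))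
    have h2 := (continuousOn_iff_continuous_domRestrict.1
      (hl (P.outcome n ω)).continuousOn).tendsto (V ω)
    exact ((h2.comp h1).const_sub _).const_mul _

/-- Quadratic growth at a minimizer: comparing `U` with `(1 - s)U + sV` instead of `V`, dividing by
`s` and letting `s` tend to `0` recovers the full strong convexity term. -/
theorem IsBayesOptimal.integral_mul_sub_add_nonpos [IsProbabilityMeasure μ]
    (hopt : IsBayesOptimal P loss f) (hρ : 0 < ρ)
    (hm : ∀ y ∈ Y, Measurable fun x => loss x y) (hs : ∀ x, StrongConvexOn Y ρ (loss x))
    (hl : ∀ x, LipschitzOnWith κ (loss x) Y) {n : ℕ} (hn : 1 ≤ n) {U V : Ω → Y}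
    (hU : Measurable[P.sigma n] U) (hV : Measurable[P.sigma n] V)
    {W : Ω → ℝ} (hW : Measurable[P.sigma n] W) {b : ℝ} (hW0 : ∀ ω, 0 ≤ W ω) (hWb : ∀ ω, W ω ≤ b)
    (hWf : ∀ ω, W ω ≠ 0 → f (P.history n ω) = some (U ω)) (hf : f.IsMeasurable) :
    Integrable (fun ω => W ω * (loss (P.outcome n ω) (U ω) - loss (P.outcome n ω) (V ω) +
      ρ / 2 * ‖(U ω : E) - V ω‖ ^ 2)) μ ∧
    ∫ ω, W ω * (loss (P.outcome n ω) (U ω) - loss (P.outcome n ω) (V ω) +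
      ρ / 2 * ‖(U ω : E) - V ω‖ ^ 2) ∂μ ≤ 0 := by
  have hle := P.sigma_le n
  obtain ⟨ω₀⟩ : Nonempty Ω := nonempty_of_isProbabilityMeasure μ
  have hL := measurable_loss hm fun x => (hl x).continuousOn
  have hLm : ∀ {V : Ω → Y}, Measurable[P.sigma n] V →
      Measurable fun ω => loss (P.outcome n ω) (V ω) := fun {V} hV =>
    hL.comp ((P.measurable_outcome n).prodMk (hV.mono hle le_rfl))
  have hbd : ∀ x, ∀ y y' : Y, |loss x y - loss x y'| ≤ κ * (4 * κ / ρ) := fun x y y' =>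
    abs_sub_le_of_strongConvexOn hρ (hs x) (hl x) y.2 y'.2
  have hb0 : 0 ≤ b := (hW0 ω₀).trans (hWb ω₀)
  have hWm := (hW.mono hle le_rfl)
  have hUm : Measurable fun ω => (U ω : E) := measurable_subtype_coe.comp (hU.mono hle le_rfl)
  have hVm : Measurable fun ω => (V ω : E) := measurable_subtype_coe.comp (hV.mono hle le_rfl)
  have hint : ∀ {V : Ω → Y}, Measurable[P.sigma n] V →
      Integrable (fun ω => W ω * (loss (P.outcome n ω) (U ω) - loss (P.outcome n ω) (V ω))) μ := by
    intro V hV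
    refine Integrable.of_bound (hWm.mul
      ((hLm hU).sub (hLm hV))).aestronglyMeasurable (b * (κ * (4 * κ / ρ))) (ae_of_all _ fun ω => ?_)
    rw [norm_mul, Real.norm_of_nonneg (hW0 ω)]
    exact mul_le_mul (hWb ω) (hbd _ _ _) (norm_nonneg _) hb0
  have hint2 : Integrable (fun ω => W ω * (ρ / 2 * ‖(U ω : E) - V ω‖ ^ 2)) μ := by
    refine Integrable.of_bound (hWm.mul
      (((hUm.sub hVm).norm.pow_const 2).const_mul _)).aestronglyMeasurable
      (b * (ρ / 2 * (4 * κ / ρ) ^ 2)) (ae_of_all _ fun ω => ?_)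
    rw [norm_mul, Real.norm_of_nonneg (hW0 ω), Real.norm_of_nonneg (by positivity)]
    have : ‖(U ω : E) - V ω‖ ≤ 4 * κ / ρ := by
      rw [le_div_iff₀ hρ, mul_comm]
      exact mul_norm_sub_le_of_strongConvexOn (hs (P.outcome n ω)) (hl _) (U ω).2 (V ω).2
    have h1 := hWb ω
    gcongr
  simp only [mul_add]
  refine ⟨(hint hV).add hint2, ?_⟩
  rw [integral_add (hint hV) hint2]
  set A := ∫ ω, W ω * (loss (P.outcome n ω) (U ω) - loss (P.outcome n ω) (V ω)) ∂μ
  set B := ∫ ω, W ω * (ρ / 2 * ‖(U ω : E) - V ω‖ ^ 2) ∂μ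
  have key : ∀ s : ℝ, 0 < s → s < 1 → A + (1 - s) * B ≤ 0 := by
    intro s hs0 hs1
    let Vs : Ω → Y := fun ω => ⟨(1 - s) • (U ω : E) + s • (V ω : E),
      (hs (P.outcome n ω)).1 (U ω).2 (V ω).2 (by linarith) hs0.le (by ring)⟩
    have hVs : Measurable[P.sigma n] Vs :=
      Measurable.subtype_mk (((measurable_subtype_coe.comp hU).const_smul (1 - s)).add
        ((measurable_subtype_coe.comp hV).const_smul s))
    have h1 := hopt.integral_mul_sub_nonpos hρ hm hs hl hn hU hVs hW hW0 hWb hWf hf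
    have h2 : s * (A + (1 - s) * B) ≤
        ∫ ω, W ω * (loss (P.outcome n ω) (U ω) - loss (P.outcome n ω) (Vs ω)) ∂μ := by
      rw [mul_add, ← integral_const_mul, ← integral_const_mul, ← integral_const_mul,
        ← integral_add ((hint hV).const_mul s) ((hint2.const_mul _).const_mul s)]
      refine integral_mono (((hint hV).const_mul s).add ((hint2.const_mul _).const_mul s))
        (hint hVs) fun ω => ?_
      obtain ⟨-, h3⟩ := hs (P.outcome n ω)
      replace h3 := h3 (U ω).2 (V ω).2 (a := 1 - s) (b := s) (by linarith) hs0.le (by ring)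
      simp only [smul_eq_mul] at h3
      have h4 := mul_le_mul_of_nonneg_left h3 (hW0 ω)
      simp only [Vs]
      nlinarith
    by_contra hcon
    push Not at hcon
    nlinarith [mul_pos hs0 hcon]
  by_contra hcon
  push Not at hcon
  have hB : 0 ≤ B := integral_nonneg fun ω => mul_nonneg (hW0 ω) (by positivity)
  -- If `A + B > 0`, this `s` satisfies `sB ≤ (A + B)/2`, so `A + (1 - s)B` would still be positive.
  have h3 := key ((A + B) / (A + B + B + 1) / 2) (by positivity) (by
    rw [div_div, div_lt_one (by positivity)]; linarith)
  have h4 : (A + B) / (A + B + B + 1) / 2 * B ≤ (A + B) / 2 := by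
    rw [div_div, div_mul_eq_mul_div, div_le_div_iff₀ (by positivity) (by positivity)]
    nlinarith [mul_nonneg hcon.le hB]
  nlinarith

/-- At a time at which a Bayes-optimal forecaster disagrees with another one, the exponential
moment of the difference of the losses is at most `1`, even after multiplication with
`exp c`. -/
theorem IsBayesOptimal.integral_mul_exp_le [IsProbabilityMeasure μ]
    (hopt : IsBayesOptimal P loss f) (hρ : 0 < ρ)
    (hm : ∀ y ∈ Y, Measurable fun x => loss x y) (hs : ∀ x, StrongConvexOn Y ρ (loss x))
    (hl : ∀ x, LipschitzOnWith κ (loss x) Y) (hf : f.IsMeasurable) (hf' : f'.IsMeasurable)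
    {n : ℕ} (hn : 1 ≤ n) {W : Ω → ℝ} (hW : Measurable[P.sigma n] W) {b : ℝ}
    (hW0 : ∀ ω, 0 ≤ W ω) (hWb : ∀ ω, W ω ≤ b) {m : ℕ}
    (hWd : ∀ ω, W ω ≠ 0 → Disagree f f' m (P.history n ω)) {l c : ℝ} (hl0 : 0 ≤ l)
    (hlk : 4 * (l * (κ : ℝ) ^ 2) ≤ ρ)
    (hc : c ≤ l * (ρ / 2 - l * (κ : ℝ) ^ 2) * (1 / (m : ℝ)) ^ 2) :
    ∫ ω, W ω * Real.exp (l * P.lossDiff loss f f' n ω + c) ∂μ ≤ ∫ ω, W ω ∂μ := by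
  -- Unless `W` vanishes identically, a point where it does not supplies the default prediction `y₀`
  -- that makes `U` and `V` total.
  by_cases hY : ∀ ω, W ω = 0
  · simp [hY]
  push Not at hY
  obtain ⟨ω₀, hω₀⟩ := hY
  obtain ⟨y₀, -⟩ := hWd ω₀ hω₀
  have hle := P.sigma_le n
  have hb0 : 0 ≤ b := (hW0 ω₀).trans (hWb ω₀)
  let U : Ω → Y := fun ω => (f (P.history n ω)).getD y₀
  let V : Ω → Y := fun ω => (f' (P.history n ω)).getD y₀
  have hU : Measurable[P.sigma n] U :=
    (measurable_getD y₀).comp (hf.measurable.comp (P.measurable_history n))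
  have hV : Measurable[P.sigma n] V :=
    (measurable_getD y₀).comp (hf'.measurable.comp (P.measurable_history n))
  have hWU : ∀ ω, W ω ≠ 0 → f (P.history n ω) = some (U ω) ∧ f' (P.history n ω) = some (V ω) ∧
      1 / (m : ℝ) ≤ ‖(U ω : E) - V ω‖ := by
    intro ω h
    obtain ⟨y, y', h1, h2, -, h4⟩ := hWd ω h
    simp only [U, V, h1, h2, Option.getD_some, true_and]
    exact h4.le
  obtain ⟨hI, hI0⟩ := hopt.integral_mul_sub_add_nonpos hρ hm hs hl hn hU hV hW hW0 hWb
    (fun ω h => (hWU ω h).1) hf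
  have hWm := hW.mono hle le_rfl
  have hWi : Integrable W μ := Integrable.of_bound hWm.aestronglyMeasurable b
    (ae_of_all _ fun ω => by rw [Real.norm_of_nonneg (hW0 ω)]; exact hWb ω)
  have hEi : Integrable (fun ω => W ω * Real.exp (l * P.lossDiff loss f f' n ω + c)) μ := by
    refine hWi.mul_bdd (c := Real.exp (l * (κ * (4 * κ / ρ)) + c)) ?_ (ae_of_all _ fun ω => ?_)
    · exact (Real.measurable_exp.comp (((P.measurable_lossDiff hm hl hf hf' n).const_mul
        l).add_const c)).aestronglyMeasurable
    · rw [Real.norm_of_nonneg (Real.exp_pos _).le]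
      have := (le_abs_self _).trans (P.abs_lossDiff_le (f := f) (f' := f') hρ hs hl n ω)
      gcongr
  calc _ ≤ ∫ ω, (W ω + Real.exp c * l * (W ω * (loss (P.outcome n ω) (U ω) -
        loss (P.outcome n ω) (V ω) + ρ / 2 * ‖(U ω : E) - V ω‖ ^ 2))) ∂μ := by
        refine integral_mono hEi (hWi.add (hI.const_mul _)) fun ω => ?_
        by_cases h : W ω = 0
        · simp [h]
        obtain ⟨h1, h2, h3⟩ := hWU ω h
        have hδ : ρ * ‖(U ω : E) - V ω‖ ≤ 4 * κ :=
          mul_norm_sub_le_of_strongConvexOn (hs (P.outcome n ω)) (hl _) (U ω).2 (V ω).2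
        have hd := (hl (P.outcome n ω)).dist_le_mul _ (U ω).2 _ (V ω).2
        rw [Real.dist_eq, dist_eq_norm] at hd
        -- From `ρδ ≤ 4κ` and `4lκ² ≤ ρ`: the exponent stays in the range where the quadratic bound
        -- on `exp` is valid.
        have hlk' : l * (κ * ‖(U ω : E) - V ω‖) ≤ 1 := by
          have h5 := mul_le_mul_of_nonneg_left hδ (mul_nonneg hl0 κ.2)
          refine le_of_mul_le_mul_left ?_ hρ
          simp only [NNReal.val_eq_coe] at h5
          nlinarith
        have := exp_mul_add_le hl0 hlk' hd h3 (by positivity)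
          (r := ρ) (by linarith) hc
        have h6 := mul_le_mul_of_nonneg_left this (hW0 ω)
        have h7 : P.lossDiff loss f f' n ω =
            loss (P.outcome n ω) (U ω) - loss (P.outcome n ω) (V ω) := by
          simp only [Environment.lossDiff, h1, h2]
        dsimp only
        rw [h7]
        linarith
    _ = ∫ ω, W ω ∂μ + Real.exp c * l * ∫ ω, W ω * (loss (P.outcome n ω) (U ω) -
        loss (P.outcome n ω) (V ω) + ρ / 2 * ‖(U ω : E) - V ω‖ ^ 2) ∂μ := by
        rw [integral_add hWi (hI.const_mul _), integral_const_mul]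
    _ ≤ _ := by
        have : 0 ≤ Real.exp c * l := by positivity
        nlinarith

end Optimality

/-! ### Exponential scores and the maximal inequality. -/

section ExpScore

variable {X : Type*} {E : Type*} [NormedAddCommGroup E] {Y : Set E}

/-- The exponential of the (shifted and scaled) differences of the losses, accumulated over the
outputs of `TestSeq` after `k` rounds. -/
noncomputable def expScore (loss : X → E → ℝ) (f f' : Forecaster X Y) (m : ℕ) (l c : ℝ) (k : ℕ)
    (o : List (Observation X)) : ℝ :=
  ((testState f f' m o k).out.map fun s =>
    Real.exp (l * scoreTerm loss 0 0 f f' 0 o s + c)).prod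

theorem expScore_pos {loss : X → E → ℝ} {f f' : Forecaster X Y} {m : ℕ} {l c : ℝ}
    (k : ℕ) (o : List (Observation X)) : 0 < expScore loss f f' m l c k o := by
  refine List.prod_pos fun a ha => ?_
  obtain ⟨s, -, rfl⟩ := List.mem_map.1 ha
  exact Real.exp_pos _

end ExpScore

section Maximal

variable {X : Type*} [MeasurableSpace X] {Ω : Type*} [MeasurableSpace Ω] {μ : Measure Ω}
  {P : Environment X μ}
  {E : Type*} [NormedAddCommGroup E] {Y : Set E} {ρ : ℝ} {κ : NNReal} {loss : X → E → ℝ}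
  {f f' : Forecaster X Y} {m : ℕ} {l c : ℝ}

theorem Environment.ConsistentAt.expScore_eq {ω : Ω} (hω : P.ConsistentAt ω) (n : ℕ) :
    expScore loss f f' m l c n (P.history n ω) = ((P.state f f' m n ω).out.map fun s =>
      Real.exp (l * P.lossDiff loss f f' s ω + c)).prod := by
  rw [expScore, ← Environment.state]
  congr 1
  refine List.map_congr_left fun s hs => ?_
  obtain ⟨h1, h2, h3, h4⟩ := (P.state_spec f f' m n ω).1 s hs
  rw [hω.scoreTerm_eq loss 0 0 f f' m 0 h1 h2 h3 h4]
  simp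

/-- `expScore`, together with the contribution of the prediction whose feedback is being waited
for. -/
noncomputable def Environment.pendingExpScore (P : Environment X μ) (loss : X → E → ℝ)
    (f f' : Forecaster X Y) (m : ℕ) (l c : ℝ) (n : ℕ) (ω : Ω) : ℝ :=
  expScore loss f f' m l c n (P.history n ω) * (P.state f f' m n ω).waiting.elim 1 fun t =>
    Real.exp (l * P.lossDiff loss f f' t ω + c)

-- Arriving feedback only moves a factor from pending to settled. The product changes only when a
-- test starts, at a time when the new factor can be conditioned on the observations.
open Classical in
theorem Environment.ConsistentAt.pendingExpScore_succ {ω : Ω} (hω : P.ConsistentAt ω) (n : ℕ) :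
    P.pendingExpScore loss f f' m l c (n + 1) ω = P.pendingExpScore loss f f' m l c n ω *
      if (P.state f f' m n ω).waiting = none ∧ Disagree f f' m (P.history (n + 1) ω) then
        Real.exp (l * P.lossDiff loss f f' (n + 1) ω + c) else 1 := by
  simp only [Environment.pendingExpScore, hω.expScore_eq]
  rw [P.state_succ]
  cases hw : (P.state f f' m n ω).waiting with
  | none => by_cases h : Disagree f f' m (P.history (n + 1) ω) <;> simp [h, hw]
  | some t => by_cases h : ((P.obs (n + 1) ω).val t).isSome <;> simp [h, hw]

/-- The settled score changes only through an output, after which nothing is pending. So when the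
settled score first crosses a level, the pending score equals it. -/
theorem Environment.ConsistentAt.pendingExpScore_eq_or {ω : Ω} (hω : P.ConsistentAt ω) (n : ℕ) :
    P.pendingExpScore loss f f' m l c (n + 1) ω =
        expScore loss f f' m l c (n + 1) (P.history (n + 1) ω) ∨
      expScore loss f f' m l c (n + 1) (P.history (n + 1) ω) =
        expScore loss f f' m l c n (P.history n ω) := by
  classical
  simp only [Environment.pendingExpScore, hω.expScore_eq]
  rw [P.state_succ]
  cases hw : (P.state f f' m n ω).waiting with
  | none => by_cases h : Disagree f f' m (P.history (n + 1) ω) <;> simp [h]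
  | some t => by_cases h : ((P.obs (n + 1) ω).val t).isSome <;> simp [h]

theorem Environment.measurable_history_of_le (P : Environment X μ) {k n : ℕ} (h : k ≤ n) :
    Measurable[P.sigma n] (P.history k) := by
  convert (measurable_list_take k).comp (P.measurable_history n) using 1
  funext ω
  exact (P.take_history h ω).symm

variable [MeasurableSpace E] [BorelSpace E] [SecondCountableTopology E]

theorem measurable_expScore (hm : ∀ y ∈ Y, Measurable fun x => loss x y)
    (hc : ∀ x, ContinuousOn (loss x) Y) (hf : f.IsMeasurable) (hf' : f'.IsMeasurable) (k : ℕ) :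
    Measurable (expScore loss f f' m l c k) := by
  have h : Measurable fun p : List (Observation X) × TestState =>
      (p.2.out.map fun s => Real.exp (l * scoreTerm loss 0 0 f f' 0 p.1 s + c)).prod := by
    refine measurable_from_prod_countable_left fun st => ?_
    rcases st with ⟨L, w⟩
    induction L with
    | nil => simp
    | cons s L ih =>
      simp only [List.map_cons, List.prod_cons] at ih ⊢
      exact (Real.measurable_exp.comp
        (((measurable_scoreTerm hm hc hf hf' 0 0 0 s).const_mul l).add_const c)).mul ih
  exact h.comp (measurable_id.prodMk (measurable_testState hf hf' m k))

theorem Environment.measurable_state_of_le (P : Environment X μ) (hf : f.IsMeasurable)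
    (hf' : f'.IsMeasurable) {k n : ℕ} (h : k ≤ n) :
    Measurable[P.sigma n] (P.state f f' m k) :=
  (measurable_testState hf hf' m k).comp (P.measurable_history_of_le h)

theorem Environment.measurable_pendingExpScore
    (P : Environment X μ) (hm : ∀ y ∈ Y, Measurable fun x => loss x y)
    (hl : ∀ x, LipschitzOnWith κ (loss x) Y) (hf : f.IsMeasurable)
    (hf' : f'.IsMeasurable) (n : ℕ) :
    Measurable (P.pendingExpScore loss f f' m l c n) := by
  have h : Measurable fun p : Ω × TestState =>
      p.2.waiting.elim 1 fun t => Real.exp (l * P.lossDiff loss f f' t p.1 + c) := by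
    refine measurable_from_prod_countable_left fun st => ?_
    rcases st with ⟨L, _ | t⟩
    · simp
    · exact Real.measurable_exp.comp
        (((P.measurable_lossDiff hm hl hf hf' t).const_mul l).add_const c)
  refine Measurable.mul ?_ (h.comp (measurable_id.prodMk
    ((P.measurable_state_of_le hf hf' le_rfl).mono (P.sigma_le n) le_rfl)))
  exact ((measurable_expScore hm (fun x => (hl x).continuousOn) hf hf' n).comp
    (P.measurable_history n)).mono (P.sigma_le n) le_rfl

/-- A maximal inequality: the exponential scores against a Bayes-optimal forecaster form, in
effect, a nonnegative supermartingale. -/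
theorem IsBayesOptimal.measure_exists_expScore_ge_le [NormedSpace ℝ E] [IsProbabilityMeasure μ]
    (hopt : IsBayesOptimal P loss f) (hρ : 0 < ρ)
    (hm : ∀ y ∈ Y, Measurable fun x => loss x y) (hs : ∀ x, StrongConvexOn Y ρ (loss x))
    (hl : ∀ x, LipschitzOnWith κ (loss x) Y) (hf : f.IsMeasurable) (hf' : f'.IsMeasurable)
    (hl0 : 0 ≤ l) (hlk : 4 * (l * (κ : ℝ) ^ 2) ≤ ρ)
    (hc : c ≤ l * (ρ / 2 - l * (κ : ℝ) ^ 2) * (1 / (m : ℝ)) ^ 2) {A : ℝ} (hA : 0 < A) :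
    μ {ω | ∃ n, A ≤ expScore loss f f' m l c n (P.history n ω)} ≤ ENNReal.ofReal (1 / A) := by
  classical
  let Q : ℕ → Ω → ℝ := fun n ω => expScore loss f f' m l c n (P.history n ω)
  let M : ℕ → Ω → ℝ := P.pendingExpScore loss f f' m l c
  -- Stopping is governed by the settled score `Q`, which is a function of the observations. The
  -- pending score `M` is not, as it involves an outcome perhaps not yet revealed.
  let a : ℕ → Set Ω := fun n => {ω | ∀ k ≤ n, Q k ω < A}
  let J : ℕ → Ω → ℝ := fun n ω => if ω ∈ a n then M n ω else A
  have hcont : ∀ x, ContinuousOn (loss x) Y := fun x => (hl x).continuousOn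
  have hQ : ∀ {k n}, k ≤ n → Measurable[P.sigma n] (Q k) := fun {k n} hkn =>
    (measurable_expScore hm hcont hf hf' k).comp (P.measurable_history_of_le hkn)
  have hQ0 : ∀ n ω, 0 < Q n ω := fun n ω => expScore_pos _ _
  have hM : ∀ n, Measurable (M n) := fun n => P.measurable_pendingExpScore hm hl hf hf' n
  have ha : ∀ {n n'}, n ≤ n' → MeasurableSet[P.sigma n'] (a n) := by
    intro n n' hnn
    have : a n = ⋂ k, ⋂ (_ : k ≤ n), Q k ⁻¹' Set.Iio A := by ext ω; simp [a]
    rw [this]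
    exact MeasurableSet.iInter fun k => MeasurableSet.iInter fun hk =>
      hQ (hk.trans hnn) measurableSet_Iio
  have ha' : ∀ n, MeasurableSet (a n) := fun n => P.sigma_le n _ (ha le_rfl)
  have hM0 : ∀ n ω, 0 ≤ M n ω := fun n ω => by
    refine mul_nonneg (hQ0 n ω).le ?_
    cases (P.state f f' m n ω).waiting with
    | none => simp
    | some t => exact (Real.exp_pos _).le
  -- `B` bounds the at most one pending factor, so the stopped process `J` is bounded by `A * B`.
  set B : ℝ := 1 + Real.exp (l * (κ * (4 * κ / ρ)) + c) with hB
  have hB1 : 1 ≤ B := by rw [hB]; linarith [Real.exp_pos (l * (κ * (4 * κ / ρ)) + c)]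
  have hMB : ∀ n ω, M n ω ≤ Q n ω * B := fun n ω => by
    refine mul_le_mul_of_nonneg_left ?_ (hQ0 n ω).le
    cases (P.state f f' m n ω).waiting with
    | none => exact hB1
    | some t =>
      have := (le_abs_self _).trans (P.abs_lossDiff_le (f := f) (f' := f') hρ hs hl t ω)
      have h2 : Real.exp (l * P.lossDiff loss f f' t ω + c) ≤
          Real.exp (l * (κ * (4 * κ / ρ)) + c) := by gcongr
      simp only [Option.elim, hB]
      linarith
  have hJ0 : ∀ n ω, 0 ≤ J n ω := fun n ω => by
    dsimp only [J]; split_ifs; exacts [hM0 n ω, hA.le]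
  have hJi : ∀ n, Integrable (J n) μ := fun n => by
    refine Integrable.of_bound (Measurable.ite (ha' n) (hM n)
      measurable_const).aestronglyMeasurable (A * B) (ae_of_all _ fun ω => ?_)
    rw [Real.norm_of_nonneg (hJ0 n ω)]
    dsimp only [J]
    split_ifs with h
    · exact (hMB n ω).trans (mul_le_mul_of_nonneg_right (h n le_rfl).le (by linarith))
    · nlinarith
  have hstep : ∀ n, ∫ ω, J (n + 1) ω ∂μ ≤ ∫ ω, J n ω ∂μ := by
    intro n
    -- `W` is the part of `J n` that is multiplied by a new factor in round `n + 1`. When a test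
    -- starts nothing is pending, so there `M n = Q n` and `W` is measurable with respect to the
    -- observations.
    let W : Ω → ℝ := fun ω => if ω ∈ a n ∧ (P.state f f' m n ω).waiting = none ∧
      Disagree f f' m (P.history (n + 1) ω) then Q n ω else 0
    have hstart : MeasurableSet[P.sigma (n + 1)] {ω | (P.state f f' m n ω).waiting = none ∧
        Disagree f f' m (P.history (n + 1) ω)} := by
      refine MeasurableSet.inter ?_ (P.measurable_history (n + 1) (measurableSet_disagree hf hf' m))
      exact P.measurable_state_of_le hf hf' n.le_succ
        (show MeasurableSet {s : TestState | s.waiting = none} from trivial)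
    have hW : Measurable[P.sigma (n + 1)] W :=
      Measurable.ite ((ha n.le_succ).inter hstart) (hQ n.le_succ) measurable_const
    have hW0 : ∀ ω, 0 ≤ W ω := fun ω => by
      dsimp only [W]; split_ifs; exacts [(hQ0 n ω).le, le_rfl]
    have hWA : ∀ ω, W ω ≤ A := fun ω => by
      dsimp only [W]; split_ifs with h; exacts [(h.1 n le_rfl).le, hA.le]
    have hWd : ∀ ω, W ω ≠ 0 → Disagree f f' m (P.history (n + 1) ω) := fun ω h => by
      by_contra hcon
      simp [W, hcon] at h
    have hexp := hopt.integral_mul_exp_le hρ hm hs hl hf hf' (Nat.le_add_left 1 n) hW hW0 hWA hWd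
      hl0 hlk hc
    have hWi : Integrable W μ := Integrable.of_bound
      (hW.mono (P.sigma_le _) le_rfl).aestronglyMeasurable A
      (ae_of_all _ fun ω => by rw [Real.norm_of_nonneg (hW0 ω)]; exact hWA ω)
    have hEi : Integrable
        (fun ω => W ω * Real.exp (l * P.lossDiff loss f f' (n + 1) ω + c)) μ := by
      refine hWi.mul_bdd (c := Real.exp (l * (κ * (4 * κ / ρ)) + c)) ?_ (ae_of_all _ fun ω => ?_)
      · exact (Real.measurable_exp.comp (((P.measurable_lossDiff hm hl hf hf' _).const_mul
          l).add_const c)).aestronglyMeasurable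
      · rw [Real.norm_of_nonneg (Real.exp_pos _).le]
        have := (le_abs_self _).trans (P.abs_lossDiff_le (f := f) (f' := f') hρ hs hl (n + 1) ω)
        gcongr
    calc ∫ ω, J (n + 1) ω ∂μ ≤ ∫ ω, (J n ω - W ω +
          W ω * Real.exp (l * P.lossDiff loss f f' (n + 1) ω + c)) ∂μ := by
          refine integral_mono_ae (hJi _) (((hJi n).sub hWi).add hEi) ?_
          filter_upwards [P.ae_consistentAt] with ω hω
          have h1 := hω.pendingExpScore_succ (loss := loss) (f := f) (f' := f') (m := m)
            (l := l) (c := c) n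
          have h2 := hω.pendingExpScore_eq_or (loss := loss) (f := f) (f' := f') (m := m)
            (l := l) (c := c) n
          have hsucc : ω ∈ a (n + 1) ↔ ω ∈ a n ∧ Q (n + 1) ω < A := by
            refine ⟨fun h => ⟨fun k hk => h k (by omega), h _ le_rfl⟩, fun h k hk => ?_⟩
            rcases Nat.le_succ_iff.1 hk with hk | rfl
            exacts [h.1 k hk, h.2]
          by_cases han : ω ∈ a n
          · have h3 : J (n + 1) ω ≤ M (n + 1) ω := by
              dsimp only [J]
              split_ifs with h
              · exact le_rfl
              · have h4 : A ≤ Q (n + 1) ω := not_lt.1 fun h5 => h (hsucc.2 ⟨han, h5⟩)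
                rcases h2 with h2 | h2
                · exact h4.trans h2.ge
                · exact absurd (h4.trans h2.le) (not_le.2 (han n le_rfl))
            refine h3.trans ?_
            change P.pendingExpScore loss f f' m l c (n + 1) ω ≤ _
            rw [h1]
            by_cases hst : (P.state f f' m n ω).waiting = none ∧
                Disagree f f' m (P.history (n + 1) ω)
            · have h6 : M n ω = Q n ω := by
                simp [M, Q, Environment.pendingExpScore, hst.1]
              simp only [J, W, han, hst, if_true, and_self]
              change M n ω * _ ≤ _
              rw [h6]
              linarith
            · simp only [J, W, han, hst, if_true, if_false, and_false]
              simp [M]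
          · have : ω ∉ a (n + 1) := fun h => han (hsucc.1 h).1
            simp [J, W, han, this]
      _ = ∫ ω, J n ω ∂μ - ∫ ω, W ω ∂μ +
          ∫ ω, W ω * Real.exp (l * P.lossDiff loss f f' (n + 1) ω + c) ∂μ := by
          have hJW : Integrable (fun ω => J n ω - W ω) μ := (hJi n).sub hWi
          rw [integral_add hJW hEi, integral_sub (hJi n) hWi]
      _ ≤ _ := by linarith
  have hJ1 : ∀ n, ∫ ω, J n ω ∂μ ≤ 1 := by
    intro n
    induction n with
    | zero =>
      have h1 : ∀ ω, J 0 ω ≤ 1 := fun ω => by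
        have hQ1 : Q 0 ω = 1 := by simp [Q, expScore, testState]
        have hM1 : M 0 ω = 1 := by
          simp [M, Environment.pendingExpScore, Environment.state, expScore, testState]
        dsimp only [J]
        split_ifs with h
        · exact hM1.le
        · by_contra hcon
          refine h fun k hk => ?_
          obtain rfl : k = 0 := by omega
          linarith
      calc ∫ ω, J 0 ω ∂μ ≤ ∫ _, (1 : ℝ) ∂μ := integral_mono (hJi 0) (integrable_const _) h1
        _ = 1 := by simp
    | succ n ih => exact (hstep n).trans ih
  have hset : {ω | ∃ n, A ≤ expScore loss f f' m l c n (P.history n ω)} = ⋃ n, (a n)ᶜ := by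
    ext ω
    simp only [Set.mem_ofPred_eq, Set.mem_iUnion, Set.mem_compl_iff, a, not_forall, not_lt]
    exact ⟨fun ⟨n, h⟩ => ⟨n, n, le_rfl, h⟩, fun ⟨_, k, _, h⟩ => ⟨k, h⟩⟩
  have hmono : Monotone fun n => (a n)ᶜ := fun n n' h =>
    Set.compl_subset_compl.2 fun ω hω k hk => hω k (hk.trans h)
  rw [hset, hmono.measure_iUnion]
  refine iSup_le fun n => ?_
  -- Markov's inequality: `J n` equals `A` on the paths already stopped, and its mean is at most
  -- `1`.
  have h1 := mul_meas_ge_le_integral_of_nonneg (ae_of_all μ (hJ0 n)) (hJi n) A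
  have h2 : μ.real (a n)ᶜ ≤ μ.real {ω | A ≤ J n ω} := measureReal_mono fun ω hω => by
    simp only [Set.mem_ofPred_eq, J, if_neg hω, le_refl]
  rw [← ofReal_measureReal]
  refine ENNReal.ofReal_le_ofReal ?_
  rw [le_div_iff₀ hA, mul_comm]
  exact (mul_le_mul_of_nonneg_left h2 hA.le).trans (h1.trans (hJ1 n))

end Maximal

/-! ### Comparison of the scores, and the excess loss. -/

section Scores

variable {X : Type*} {E : Type*} [NormedAddCommGroup E] {Y : Set E}

theorem exists_evOp_eq {K : ℕ} (loss : X → E → ℝ) (ρ ε : ℝ) (F : Fin K → Forecaster X Y)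
    {z : Fin K} {o : List (Observation X)} (hz : (F z o).isSome) :
    ∃ i, (F i o).isSome ∧ evOp loss ρ ε F o = F i o ∧
      maxScore loss ρ ε F i o ≤ maxScore loss ρ ε F z o := by
  classical
  have hmem : z ∈ (List.finRange K).filter fun i => (F i o).isSome := by simp [hz]
  cases h : ((List.finRange K).filter fun i => (F i o).isSome).argmin
      fun i => maxScore loss ρ ε F i o with
  | none => rw [List.argmin_eq_none.1 h] at hmem; simp at hmem
  | some i =>
    refine ⟨i, ?_, ?_, List.le_of_mem_argmin hmem h⟩
    · simpa using List.argmin_mem h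
    · have : evOp loss ρ ε F o = (((List.finRange K).filter fun i => (F i o).isSome).argmin
        fun i => maxScore loss ρ ε F i o).bind fun i => F i o := rfl
      rw [this, h, Option.bind_some]

theorem sum_map_mul_add (L : List ℕ) (D : ℕ → ℝ) (l c b : ℝ) :
    (L.map fun s => l * D s + c).sum =
      l * (L.map fun s => D s - b).sum + (c + l * b) * L.length := by
  induction L with
  | nil => simp
  | cons s L ih => simp only [List.map_cons, List.sum_cons, List.length_cons, ih]; push_cast; ring

variable [MeasurableSpace X] {Ω : Type*} [MeasurableSpace Ω] {μ : Measure Ω}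
  {P : Environment X μ} {loss : X → E → ℝ} {f f' : Forecaster X Y}

/-- For `c = -l · ρε/(2m²)` the term with the number of outputs disappears and only `exp(l ·
RelScore)` is left. -/
theorem Environment.ConsistentAt.expScore_eq_exp_relScore {ω : Ω} (hω : P.ConsistentAt ω)
    (ρ ε l c : ℝ) (m n : ℕ) :
    expScore loss f f' m l c n (P.history n ω) =
      Real.exp (l * relScore loss ρ ε f f' m (P.history n ω) +
        (c + l * (ρ * ε / (2 * (m : ℝ) ^ 2))) * (P.state f f' m n ω).out.length) := by
  rw [hω.expScore_eq, hω.relScore_eq, ← sum_map_mul_add, Real.exp_list_sum, List.map_map]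
  rfl

/-- With the forecasters exchanged the loss differences change sign but the bias does not. Any
excess of `c` over `l · ρε/(2m²)` becomes a linear drift in favour of `RelScore(j,z,m)`. -/
theorem Environment.ConsistentAt.expScore_eq_exp_relScore_swap {ω : Ω} (hω : P.ConsistentAt ω)
    (ρ ε l c : ℝ) (m n : ℕ) :
    expScore loss f f' m l c n (P.history n ω) =
      Real.exp (-l * relScore loss ρ ε f' f m (P.history n ω) +
        (c - l * (ρ * ε / (2 * (m : ℝ) ^ 2))) * (P.state f f' m n ω).out.length) := by
  have h := sum_map_mul_add (P.state f f' m n ω).out (fun s => P.lossDiff loss f' f s ω) (-l) c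
    (ρ * ε / (2 * (m : ℝ) ^ 2))
  rw [neg_mul _ (ρ * ε / _), ← sub_eq_add_neg] at h
  rw [hω.expScore_eq, hω.relScore_eq, P.state_comm f' f, ← h, Real.exp_list_sum, List.map_map]
  congr 1
  refine List.map_congr_left fun s _ => ?_
  simp only [Function.comp]
  rw [P.lossDiff_comm loss f f', neg_mul_neg]

theorem sum_excess_le {K : ℕ} {ρ ε : ℝ} {F : Fin K → Forecaster X Y} {z : Fin K} {ω : Ω} {N : ℕ}
    (hN : ∀ n, N ≤ n → (F z (P.history n ω)).isSome →
      evOp loss ρ ε F (P.history n ω) = F z (P.history n ω)) {L : ℝ} (hL : 0 ≤ L)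
    (hb : ∀ x, ∀ y ∈ Y, ∀ y' ∈ Y, loss x y - loss x y' ≤ L) (n : ℕ) :
    ∑ i ∈ (Finset.Icc 1 n).filter fun i => (F z (P.history i ω)).isSome,
      ((evOp loss ρ ε F (P.history i ω)).elim 0 (fun y => loss (P.outcome i ω) y)
        - (F z (P.history i ω)).elim 0 (fun y => loss (P.outcome i ω) y)) ≤ L * N := by
  calc _ ≤ ∑ i ∈ (Finset.Icc 1 n).filter fun i => (F z (P.history i ω)).isSome,
        if i < N then L else 0 := by
        refine Finset.sum_le_sum fun i hi => ?_
        have hz := (Finset.mem_filter.1 hi).2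
        split_ifs with h
        -- `evOp` predicts whenever `F z` does, so the term is a genuine difference of losses and
        -- the default `0` is not used.
        · obtain ⟨j, hj, hev, -⟩ := exists_evOp_eq loss ρ ε F hz
          obtain ⟨y, hy⟩ := Option.isSome_iff_exists.1 hj
          obtain ⟨y', hy'⟩ := Option.isSome_iff_exists.1 hz
          rw [hev, hy, hy']
          exact hb _ _ y.2 _ y'.2
        · rw [hN i (not_lt.1 h) hz, sub_self]
    _ = L * (((Finset.Icc 1 n).filter fun i => (F z (P.history i ω)).isSome).filter
        (· < N)).card := by
        rw [← Finset.sum_filter, Finset.sum_const, nsmul_eq_mul, mul_comm]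
    _ ≤ L * N := by
        refine mul_le_mul_of_nonneg_left ?_ hL
        have : (((Finset.Icc 1 n).filter fun i => (F z (P.history i ω)).isSome).filter
            (· < N)) ⊆ Finset.range N := fun i hi =>
          Finset.mem_range.2 (Finset.mem_filter.1 hi).2
        exact_mod_cast (Finset.card_le_card this).trans (Finset.card_range N).le

/-- Deterministic part: if the exponential scores are bounded and the test sequences are long
enough, the algorithm follows the forecaster with index `z`. -/
theorem Environment.ConsistentAt.evOp_eq {ω : Ω} (hω : P.ConsistentAt ω) {K : ℕ} {ρ ε : ℝ}
    (hρ : 0 ≤ ρ) (hε : 0 ≤ ε) {F : Fin K → Forecaster X Y} {z : Fin K} {m n : ℕ} {l c a : ℝ}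
    (hl : 0 < l)
    (h1 : ∀ j, ∀ m' : ℕ, expScore loss (F z) (F j) m' l (-(l * (ρ * ε / (2 * (m' : ℝ) ^ 2)))) n
      (P.history n ω) < Real.exp (l * (a + m')))
    (h2 : ∀ j, expScore loss (F z) (F j) m l (c + l * (ρ * ε / (2 * (m : ℝ) ^ 2))) n
      (P.history n ω) < Real.exp (l * a))
    (hlen : ∀ j, j ≠ z → l * (2 * a + 2 * K + m) ≤ c * (P.state (F z) (F j) m n ω).out.length)
    (hz : (F z (P.history n ω)).isSome) :
    evOp loss ρ ε F (P.history n ω) = F z (P.history n ω) := by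
  obtain ⟨i, hi, hev, hle⟩ := exists_evOp_eq loss ρ ε F hz
  suffices i = z by rw [hev, this]
  by_contra hiz
  have hzK : ((z : ℕ) : ℝ) ≤ K := by exact_mod_cast z.2.le
  have hup : maxScore loss ρ ε F z (P.history n ω) ≤ K + a := by
    have : Nonempty (Fin K × ℕ) := ⟨(z, 0)⟩
    refine ciSup_le fun jm => ?_
    have h3 := h1 jm.1 jm.2
    rw [hω.expScore_eq_exp_relScore ρ ε, Real.exp_lt_exp, neg_add_cancel, zero_mul, add_zero] at h3
    have h4 := lt_of_mul_lt_mul_left h3 hl.le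
    have h5 : (0 : ℝ) ≤ (jm.1 : ℕ) := Nat.cast_nonneg _
    linarith
  have hlow : ((i : ℕ) : ℝ) - (z : ℕ) - m + relScore loss ρ ε (F i) (F z) m (P.history n ω) ≤
      maxScore loss ρ ε F i (P.history n ω) :=
    -- Any selected rival `i` is tested against the competitor `z` at the given precision `m`.
    le_ciSup (bddAbove_scores loss hρ hε F i (P.history n ω)) (z, m)
  have h3 := h2 i
  rw [hω.expScore_eq_exp_relScore_swap ρ ε, Real.exp_lt_exp, add_sub_cancel_right] at h3
  have h4 := hlen i hiz
  have h5 : l * (a + 2 * K + m) < l * relScore loss ρ ε (F i) (F z) m (P.history n ω) := by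
    linarith
  have h6 := lt_of_mul_lt_mul_left h5 hl.le
  have h7 : (0 : ℝ) ≤ (i : ℕ) := Nat.cast_nonneg _
  linarith

end Scores

/-! ### The union bound and the required number of tests. -/

section Constants

/-- The extra level `m` for precision `m` turns the union over all precisions into a geometric
series with ratio `exp (-l)`. -/
theorem measure_iUnion_union_iUnion_le {Ω : Type*} [MeasurableSpace Ω] {μ : Measure Ω} {K : ℕ}
    {l a : ℝ} (hl : 0 < l) {B₁ : Fin K → ℕ → Set Ω} {B₂ : Fin K → Set Ω}
    (h1 : ∀ j m, μ (B₁ j m) ≤ ENNReal.ofReal (1 / Real.exp (l * (a + m))))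
    (h2 : ∀ j, μ (B₂ j) ≤ ENNReal.ofReal (1 / Real.exp (l * a))) :
    μ ((⋃ j, ⋃ m, B₁ j m) ∪ ⋃ j, B₂ j) ≤
      ENNReal.ofReal (K * (1 / (1 - Real.exp (-l)) + 1) * Real.exp (-(l * a))) := by
  have hq : Real.exp (-l) < 1 := Real.exp_lt_one_iff.2 (by linarith)
  have hq' : 0 < 1 - Real.exp (-l) := by linarith
  have hs := (hasSum_geometric_of_lt_one (Real.exp_pos (-l)).le hq).mul_left (Real.exp (-(l * a)))
  have e : ∀ m : ℕ, 1 / Real.exp (l * (a + m)) = Real.exp (-(l * a)) * Real.exp (-l) ^ m := by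
    intro m
    rw [one_div, ← Real.exp_neg, ← Real.exp_nat_mul, ← Real.exp_add]
    congr 1; ring
  have h3 : ∀ j, μ (⋃ m, B₁ j m) ≤
      ENNReal.ofReal (Real.exp (-(l * a)) * (1 - Real.exp (-l))⁻¹) := fun j => by
    refine (measure_iUnion_le _).trans ((ENNReal.tsum_le_tsum (h1 j)).trans ?_)
    simp only [e]
    rw [← ENNReal.ofReal_tsum_of_nonneg (fun m => by positivity) hs.summable, hs.tsum_eq]
  refine (measure_union_le _ _).trans ((add_le_add
    ((measure_iUnion_fintype_le _ _).trans (Finset.sum_le_sum fun j _ => h3 j))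
    ((measure_iUnion_fintype_le _ _).trans (Finset.sum_le_sum fun j _ => h2 j))).trans ?_)
  rw [← ENNReal.ofReal_sum_of_nonneg fun _ _ => by positivity,
    ← ENNReal.ofReal_sum_of_nonneg fun _ _ => by positivity,
    ← ENNReal.ofReal_add (Finset.sum_nonneg fun _ _ => by positivity)
      (Finset.sum_nonneg fun _ _ => by positivity)]
  refine ENNReal.ofReal_le_ofReal (le_of_eq ?_)
  simp only [Finset.sum_const, Finset.card_univ, Fintype.card_fin, nsmul_eq_mul, Real.exp_neg,
    one_div]
  ring

/-- The number of terms which suffices for a drift of `G` per term to overcome the fluctuations. -/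
theorem two_mul_add_le_mul {l G R p : ℝ} {K m r k : ℕ} (hl : 0 < l) (hG : 0 < G) (hR : 1 ≤ R)
    (hp : 0 < p) (hp1 : p ≤ 1)
    (hr : r = ⌈(1 + (2 * (1 + Real.log R) / l + 2 * K + m) / G) * (1 + Real.log (1 / p))⌉₊)
    (hk : r ≤ k + 1) :
    2 * ((Real.log (1 / p) + Real.log R) / l) + 2 * K + m ≤ G * k := by
  have hlp : 0 ≤ Real.log (1 / p) := Real.log_nonneg (by rwa [le_div_iff₀ hp, one_mul])
  have hlR : 0 ≤ Real.log R := Real.log_nonneg hR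
  set q := Real.log (1 / p)
  set T : ℝ := 2 * (1 + Real.log R) / l + 2 * K + m with hT
  have h1 : (1 + T / G) * (1 + q) ≤ k + 1 :=
    (Nat.le_ceil _).trans (by rw [← hr]; exact_mod_cast hk)
  -- The leading `1` of the constant, multiplied by `1 + q ≥ 1`, absorbs the test that may still be
  -- open.
  have h2 : T / G * (1 + q) ≤ k := by linarith [mul_nonneg hlp hlp]
  have h3 : T * (1 + q) ≤ G * k := by
    have := mul_le_mul_of_nonneg_left h2 hG.le
    rwa [← mul_assoc, mul_div_cancel₀ _ hG.ne'] at this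
  refine le_trans ?_ h3
  have h4 : (q + Real.log R) / l ≤ (1 + Real.log R) * (1 + q) / l :=
    div_le_div_of_nonneg_right (by nlinarith [mul_nonneg hlp hlR]) hl.le
  have h5 : T * (1 + q) = 2 * ((1 + Real.log R) * (1 + q) / l) + (2 * K + m) + (2 * K + m) * q := by
    rw [hT]; ring
  have h6 : 0 ≤ (2 * (K : ℝ) + m) * q := by positivity
  linarith

end Constants

end UnboundedDelay
-- Assembly of the theorem.
theorem theorem2 (ρ ε : ℝ) (κ : NNReal) (hρ : 0 < ρ) (hε : 0 < ε) (hε1 : ε < 1)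
    (m K : ℕ) (hm : 1 ≤ m) :
    ∃ C : ℝ, ∀ (d : ℕ) (Y : Set (EuclideanSpace ℝ (Fin d)))
      {X : Type*} [MeasurableSpace X] {Ω : Type*} [MeasurableSpace Ω]
      (μ : MeasureTheory.Measure Ω) [MeasureTheory.IsProbabilityMeasure μ]
      (loss : X → EuclideanSpace ℝ (Fin d) → ℝ)
      (P : UnboundedDelay.Environment X μ)
      (F : Fin K → UnboundedDelay.Forecaster X Y) (z : Fin K) (h g : ℕ → ℕ),
      Convex ℝ Y →
      (∀ y ∈ Y, Measurable fun x => loss x y) →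
      (∀ x, StrongConvexOn Y ρ (loss x)) →
      (∀ x, LipschitzOnWith κ (loss x) Y) →
      (∀ j, (F j).IsMeasurable) →
      UnboundedDelay.IsBayesOptimal P loss (F z) →
      Monotone h →
      Monotone g →
      (∀ᵐ ω ∂μ, ∀ j, j ≠ z → ∀ t, 1 ≤ t →
        ∃ t', t < t' ∧ t' < h t ∧
          UnboundedDelay.Disagree (F z) (F j) m (P.history t' ω)) →
      (∀ᵐ ω ∂μ, ∀ t, 1 ≤ t →
        ∃ k, t < k ∧ k ≤ g t ∧ ((P.obs k ω).val t).isSome) →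
      (∃ L : ℝ, ∀ x, ∀ y ∈ Y, ∀ y' ∈ Y, loss x y - loss x y' ≤ L) ∧
      ∀ p : ℝ, 0 < p → p ≤ 1 →
        ∃ N : ℕ, N = (h ∘ g)^[⌈C * (1 + Real.log (1 / p))⌉₊] 1 ∧
          ∀ L : ℝ, 0 ≤ L → (∀ x, ∀ y ∈ Y, ∀ y' ∈ Y, loss x y - loss x y' ≤ L) →
            μ {ω | ¬ ((∀ n, N ≤ n → ((F z) (P.history n ω)).isSome →
                    UnboundedDelay.evOp loss ρ ε F (P.history n ω) = (F z) (P.history n ω)) ∧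
                  ∀ n : ℕ,
                    ∑ i ∈ (Finset.Icc 1 n).filter fun i => ((F z) (P.history i ω)).isSome,
                      ((UnboundedDelay.evOp loss ρ ε F (P.history i ω)).elim 0
                          (fun y => loss (P.outcome i ω) y)
                        - ((F z) (P.history i ω)).elim 0
                          (fun y => loss (P.outcome i ω) y)) ≤ L * N)}
              ≤ ENNReal.ofReal p := by

  classical
  -- Enlarging the Lipschitz constant makes it positive, so that `l` is well defined even for `κ =
  -- 0`.
  let k : NNReal := κ + 1
  have hk : 0 < (k : ℝ) := by positivity
  let l : ℝ := ρ * (1 - ε) / (4 * (k : ℝ) ^ 2)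
  have hε' : 0 < 1 - ε := by linarith
  have hl : 0 < l := by positivity
  have hlk : l * (k : ℝ) ^ 2 = ρ * (1 - ε) / 4 := by
    simp only [l]; field_simp
  have hm0 : (0 : ℝ) < m := by exact_mod_cast hm
  -- Strong convexity offers `ρ/(2m²)` per test and the bias takes the fraction `ε` of it. By the
  -- choice of `l`, half of the remainder pays for the second-order term `l * k ^ 2`; the other half
  -- is the drift `G`.
  let G : ℝ := ρ * (1 - ε) / (4 * (m : ℝ) ^ 2)
  have hG : 0 < G := by positivity
  let R : ℝ := K * (1 / (1 - Real.exp (-l)) + 1)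
  refine ⟨1 + (2 * (1 + Real.log R) / l + 2 * K + m) / G, ?_⟩
  intro d Y X _ Ω _ μ _ loss P F z h g _ hmeas hsc hlip hF hopt hh hg ha hb
  have hlip' : ∀ x, LipschitzOnWith k (loss x) Y := fun x => (hlip x).weaken (by simp [k])
  have hK : (1 : ℝ) ≤ K := by exact_mod_cast z.pos
  have hR : 1 ≤ R := by
    have : 0 < 1 - Real.exp (-l) := by
      have := Real.exp_lt_one_iff.2 (show -l < 0 by linarith)
      linarith
    have h1 : 1 ≤ 1 / (1 - Real.exp (-l)) + 1 := by
      have : 0 < 1 / (1 - Real.exp (-l)) := by positivity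
      linarith
    exact one_le_mul_of_one_le_of_one_le hK h1
  refine ⟨⟨k * (4 * k / ρ), fun x y hy y' hy' => (le_abs_self _).trans
    (UnboundedDelay.abs_sub_le_of_strongConvexOn hρ (hsc x) (hlip' x) hy hy')⟩, ?_⟩
  intro p hp hp1
  refine ⟨_, rfl, fun L hL hLb => ?_⟩
  set r := ⌈(1 + (2 * (1 + Real.log R) / l + 2 * K + m) / G) * (1 + Real.log (1 / p))⌉₊ with hr
  -- Chosen so that the union bound gives exactly `R * exp (-(l * a)) = p`.
  let a : ℝ := (Real.log (1 / p) + Real.log R) / l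
  have hRa : R * Real.exp (-(l * a)) = p := by
    have : -(l * a) = Real.log (p / R) := by
      simp only [a]
      rw [mul_div_cancel₀ _ hl.ne', Real.log_div hp.ne' (by linarith), one_div, Real.log_inv]
      ring
    rw [this, Real.exp_log (by positivity)]
    field_simp
  -- On `B₁ j m'`, `RelScore(z,j,m')` reaches `a + m'` at some time.
  let B₁ : Fin K → ℕ → Set Ω := fun j m' => {ω | ∃ n, Real.exp (l * (a + m')) ≤
    UnboundedDelay.expScore loss (F z) (F j) m' l (-(l * (ρ * ε / (2 * (m' : ℝ) ^ 2)))) n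
      (P.history n ω)}
  -- On `B₂ j`, `RelScore(j,z,m)` at some time is at most `G` times the number of outputs, minus
  -- `a`.
  let B₂ : Fin K → Set Ω := fun j => {ω | ∃ n, Real.exp (l * a) ≤
    UnboundedDelay.expScore loss (F z) (F j) m l (l * G + l * (ρ * ε / (2 * (m : ℝ) ^ 2))) n
      (P.history n ω)}
  have hlk4 : 4 * (l * (k : ℝ) ^ 2) ≤ ρ := by rw [hlk]; nlinarith
  have hB₁ : ∀ j m', μ (B₁ j m') ≤ ENNReal.ofReal (1 / Real.exp (l * (a + m'))) := fun j m' => by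
    refine hopt.measure_exists_expScore_ge_le hρ hmeas hsc hlip' (hF z) (hF j) hl.le hlk4 ?_
      (Real.exp_pos _)
    have h1 : 0 ≤ l * (ρ * ε / (2 * (m' : ℝ) ^ 2)) := by positivity
    have h2 : 0 ≤ l * (ρ / 2 - l * (k : ℝ) ^ 2) * (1 / (m' : ℝ)) ^ 2 :=
      mul_nonneg (mul_nonneg hl.le (by linarith)) (sq_nonneg _)
    linarith
  have hB₂ : ∀ j, μ (B₂ j) ≤ ENNReal.ofReal (1 / Real.exp (l * a)) := fun j => by
    refine hopt.measure_exists_expScore_ge_le hρ hmeas hsc hlip' (hF z) (hF j) hl.le hlk4 ?_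
      (Real.exp_pos _)
    rw [hlk]
    refine le_of_eq ?_
    simp only [G]
    field_simp
    ring
  refine le_trans (MeasureTheory.measure_mono_ae ?_)
    ((UnboundedDelay.measure_iUnion_union_iUnion_le hl hB₁ hB₂).trans_eq (congrArg _ hRa))
  filter_upwards [P.ae_consistentAt, ha, hb] with ω hω haω hbω hbad
  by_contra hgood
  replace hgood := not_or.1 hgood
  simp only [B₁, B₂, Set.mem_iUnion, Set.mem_ofPred_eq, not_exists, not_le] at hgood
  obtain ⟨hg1, hg2⟩ := hgood
  have key : ∀ n, (h ∘ g)^[r] 1 ≤ n → (F z (P.history n ω)).isSome →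
      UnboundedDelay.evOp loss ρ ε F (P.history n ω) = F z (P.history n ω) := by
    intro n hn hz
    refine hω.evOp_eq hρ.le hε.le hl (fun j m' => hg1 j m' n) (fun j => hg2 j n) ?_ hz
    intro j hj
    have hlen := P.le_length_out hh hg (haω j hj) hbω hn
    have := UnboundedDelay.two_mul_add_le_mul hl hG hR hp hp1 hr hlen
    rw [mul_assoc]
    exact mul_le_mul_of_nonneg_left this hl.le
  exact hbad ⟨key, UnboundedDelay.sum_excess_le key hL hLb⟩
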